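/- **Model.** Consider $n$ queues in discrete time. In each time slot a channel state $m$ is drawn from a finite set $\mathcal M$ with probability mass function $\psi$; given $m$, the feasible service rate vectors form a finite nonempty set $\mathcal S^{(m)}\subset\mathbb R^n_+$ such that $x\in\mathcal S^{(m)}$ implies $x-x_ie^{(i)}\in\mathcal S^{(m)}$ for every $i$. If the queue lengths are $q\in\mathbb R_+^n$ and the channel state is $m$, MaxWeight selects a schedule $s\in\arg\max_{x\in\mathcal S^{(m)}}\langle q,x\rangle$, ties being broken by any (possibly random) rule depending on $(q,m)$. Then a vector of arrivals $a\in\mathbb R^n_+$ is added, and the next queue length vector is $q+a-s+u$ with $u_i=\max\{s_i-q_i-a_i,0\}$. Channel states and arrival vectors are i.i.d. over time, and the arrivals are independent of the channel states, of the selected schedule and of the current queue lengths; arrivals to different queues in one time slot may be correlated. The capacity region is $\mathcal C=\sum_{m}\psi_m\,\mathrm{conv}(\mathcal S^{(m)})$. Write $\mathcal C=\{x\in\mathbb R^n_+:\langle c^{(\ell)},x\rangle\le b^{(\ell)},\ \ell=1,\dots,L\}$ with the minimum number $L$ of half-spaces, normalized so that $c^{(\ell)}\ge0$, $\|c^{(\ell)}\|=1$,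 $b^{(\ell)}>0$, and let $\mathcal F^{(\ell)}=\{x\in\mathcal C:\langle c^{(\ell)},x\rangle=b^{(\ell)}\}$. Let $B_\ell=\max_{x\in\mathcal S^{(m)}}\langle c^{(\ell)},x\rangle$, where $m$ is random with law $\psi$. Let $\nu$ be in the boundary of $\mathcal C$, with $(1-\epsilon)\nu$ in the interior of $\mathcal C$ (in $\mathbb R^n$) for all $\epsilon\in(0,1)$ (so that all $\nu_i>0$). Let $P=\{\ell:\nu\in\mathcal F^{(\ell)}\}$; no complete resource pooling condition is imposed, that is, $P$ may have more than one element. Let $\tilde P\subseteq P$ be such that $\{c^{(\ell)}:\ell\in\tilde P\}$ is linearly independent with the same span $\mathcal H$ as $\{c^{(\ell)}:\ell\in P\}$. Let $C$ be the matrix with columns $c^{(\ell)}$, $\ell\in\tilde P$, let $H=C(C^TC)^{-1}C^T$ be the projection matrix onto $\mathcal H$, and let $\Sigma_B$ be the covariance matrix of $(B_\ell)_{\ell\in\tilde P}$. For each $\epsilon\in(0,1)$ consider the switch above under MaxWeight whose arrival vector has mean $(1-\epsilon)\nu$, covariance matrix $\Sigma_a^{(\epsilon)}$, and entries in $[0,A_{\max}]$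 almost surely, where $A_{\max}$ does not depend on $\epsilon$. Let $\bar q^{(\epsilon)}$ have a stationary distribution of the Markov chain of queue lengths. Let $\circ$ denote the entrywise product and $\mathbf 1$ the all-ones vector. **Theorem.** For all $\epsilon\in(0,1)$ and $w\in\bigcap_{\ell\in P}\mathcal F^{(\ell)}$, the variable $\langle\bar q^{(\epsilon)},w\rangle$ is integrable. There is a function $K$ with $\epsilon K(\epsilon)\to0$ as $\epsilon\downarrow0$ such that for every $w\in\bigcap_{\ell\in P}\mathcal F^{(\ell)}$ and every $\epsilon\in(0,1)$, $$\left|\mathbb E\langle\bar q^{(\epsilon)},w\rangle-\frac1{2\epsilon}\mathbf 1^T\big(H\circ\Sigma_a^{(\epsilon)}\big)\mathbf 1-\frac1{2\epsilon}\mathbf 1^T\big((C^TC)^{-1}\circ\Sigma_B\big)\mathbf 1\right|\le K(\epsilon).$$ Moreover, if $\Sigma_a^{(\epsilon)}\to\Sigma_a$ entrywise as $\epsilon\downarrow0$, then for every $w\in\bigcap_{\ell\in P}\mathcal F^{(\ell)}$ $$\lim_{\epsilon\downarrow0}\epsilon\,\mathbb E\langle\bar q^{(\epsilon)},w\rangle=\frac12\Big(\mathbf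 1^T(H\circ\Sigma_a)\mathbf 1+\mathbf 1^T\big((C^TC)^{-1}\circ\Sigma_B\big)\mathbf 1\Big).$$ -/

import Mathlib

open MeasureTheory ProbabilityTheory Filter Topology
open scoped Matrix ENNReal

/-- The primitives of a generalized switch with `n` queues and finite channel state space `M`:
the distribution `ψ` of the channel state and, for each channel state `m`, the finite set `S m` of
feasible service rate vectors, which contains the projections of its elements on the coordinate
hyperplanes. -/
structure GeneralizedSwitch (n : ℕ) (M : Type*) [Fintype M] where
  /-- probability mass function of the channel state -/
  ψ : M → ℝ
  /-- feasible service rate vectors in each channel state -/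
  S : M → Finset (Fin n → ℝ)
  ψ_mem : ψ ∈ stdSimplex ℝ M
  S_nonempty : ∀ m, (S m).Nonempty
  S_nonneg : ∀ m, ∀ x ∈ S m, ∀ i, 0 ≤ x i
  S_proj : ∀ m, ∀ x ∈ S m, ∀ i, Function.update x i 0 ∈ S m

/-- Unused service when the queue lengths are `q`, the potential service is `s` and the arrivals
are `a` (arrivals occur before service). -/
def unusedService {n : ℕ} (q s a : Fin n → ℝ) : Fin n → ℝ :=
  fun i => max (s i - (q i + a i)) 0

/-- Queue lengths at the beginning of the next time slot. -/
def nextQueue {n : ℕ} (q s a : Fin n → ℝ) : Fin n → ℝ :=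
  q + a - s + unusedService q s a

theorem measurable_nextQueue {n : ℕ} :
    Measurable (fun p : ((Fin n → ℝ) × (Fin n → ℝ)) × (Fin n → ℝ) =>
      nextQueue p.1.1 p.1.2 p.2) := by
  unfold nextQueue unusedService
  fun_prop

/-- Covariance matrix of a random vector with law `α`. -/
noncomputable def covMat {n : ℕ} (α : Measure (Fin n → ℝ)) : Matrix (Fin n) (Fin n) ℝ :=
  Matrix.of fun i j => cov[fun a => a i, fun a => a j; α]

/-- `α` is the law of a vector of arrivals in one time slot, with entries in `[0, Amax]` and
mean `lam`. The entries may be correlated. -/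
structure IsArrivalLaw {n : ℕ} (α : Measure (Fin n → ℝ)) (Amax : ℝ) (lam : Fin n → ℝ) : Prop where
  prob : IsProbabilityMeasure α
  bounded : ∀ᵐ a ∂α, ∀ i, 0 ≤ a i ∧ a i ≤ Amax
  mean : ∀ i, ∫ a, a i ∂α = lam i

/-- The polyhedron in the nonnegative orthant cut out by the half-spaces `⟨c ℓ, x⟩ ≤ b ℓ`. -/
def polyhedron {n L : ℕ} (c : Fin L → Fin n → ℝ) (b : Fin L → ℝ) : Set (Fin n → ℝ) :=
  {x | (∀ i, 0 ≤ x i) ∧ ∀ ℓ, c ℓ ⬝ᵥ x ≤ b ℓ}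

/-- The matrix whose columns are the vectors `c ℓ`, `ℓ ∈ T`. -/
def colMatrix {n L : ℕ} (c : Fin L → Fin n → ℝ) (T : Finset (Fin L)) : Matrix (Fin n) T ℝ :=
  Matrix.of fun i ℓ => c ℓ i

/-- Sum of the entries of the Hadamard product of two matrices, i.e. `1ᵀ (A ∘ B) 1`. -/
def hadamardSum {ι : Type*} [Fintype ι] (A B : Matrix ι ι ℝ) : ℝ :=
  1 ⬝ᵥ ((A ⊙ B) *ᵥ 1)

namespace GeneralizedSwitch

variable {n : ℕ} {M : Type*} [Fintype M]

/-- The capacity region `∑ m, ψ m • conv (S m)` (a Minkowski sum). -/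
def capacityRegion (sw : GeneralizedSwitch n M) : Set (Fin n → ℝ) :=
  {x | ∃ y : M → Fin n → ℝ, (∀ m, y m ∈ convexHull ℝ (sw.S m : Set (Fin n → ℝ))) ∧
    x = ∑ m, sw.ψ m • y m}

/-- The schedules that the MaxWeight algorithm may select: the maximizers of `⟨q, x⟩` over the
feasible service rate vectors in channel state `m`. -/
def maxWeightSchedules (sw : GeneralizedSwitch n M) (m : M) (q : Fin n → ℝ) :
    Set (Fin n → ℝ) :=
  {s | s ∈ sw.S m ∧ ∀ x ∈ sw.S m, q ⬝ᵥ x ≤ q ⬝ᵥ s}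

/-- A MaxWeight scheduling rule: `sched m q` is the law of the schedule selected in channel state
`m` with queue lengths `q`. It is concentrated on the maximizers, and ties are broken by an
arbitrary (possibly random) rule. -/
structure IsMaxWeight (sw : GeneralizedSwitch n M)
    (sched : M → Kernel (Fin n → ℝ) (Fin n → ℝ)) : Prop where
  markov : ∀ m, IsMarkovKernel (sched m)
  argmax : ∀ m q, ∀ᵐ s ∂(sched m q), s ∈ sw.maxWeightSchedules m q

/-- The transition kernel of the Markov chain of queue lengths: in each time slot a channel state
`m` with law `ψ` is observed, then a schedule is selected with law `sched m q`, and independently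
of these the arrivals have law `α`. -/
noncomputable def queueKernel (sw : GeneralizedSwitch n M) (α : Measure (Fin n → ℝ))
    (sched : M → Kernel (Fin n → ℝ) (Fin n → ℝ)) : Kernel (Fin n → ℝ) (Fin n → ℝ) where
  toFun q := ∑ m, ENNReal.ofReal (sw.ψ m) •
    (((Kernel.id ×ₖ sched m) ×ₖ Kernel.const _ α).map
      (fun p : ((Fin n → ℝ) × (Fin n → ℝ)) × (Fin n → ℝ) => nextQueue p.1.1 p.1.2 p.2)) q
  measurable' := by
    refine Measure.measurable_of_measurable_coe _ fun A hA => ?_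
    simp only [Measure.finsetSum_apply, Measure.smul_apply, smul_eq_mul]
    exact Finset.measurable_sum _ fun m _ => (Kernel.measurable_coe _ hA).const_mul _

/-- The law of the next queue lengths, given the current queue lengths `q`. -/
theorem queueKernel_apply (sw : GeneralizedSwitch n M) (α : Measure (Fin n → ℝ))
    [IsProbabilityMeasure α] (sched : M → Kernel (Fin n → ℝ) (Fin n → ℝ))
    [∀ m, IsMarkovKernel (sched m)] (q : Fin n → ℝ) :
    sw.queueKernel α sched q = ∑ m, ENNReal.ofReal (sw.ψ m) •
      ((sched m q).prod α).map (fun p => nextQueue q p.1 p.2) := by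
  change (∑ m, ENNReal.ofReal (sw.ψ m) • _) = _
  refine Finset.sum_congr rfl fun m _ => ?_
  congr 1
  have h : ((Measure.dirac q).prod (sched m q)).prod α =
      ((sched m q).prod α).map (fun p => ((q, p.1), p.2)) := by
    have h1 : (Measure.dirac q).prod (sched m q) = (sched m q).map (Prod.mk q) :=
      Measure.dirac_prod q
    have h2 := Measure.map_prod_map (sched m q) α (f := Prod.mk q) (g := id)
      (by fun_prop) measurable_id
    rw [h1]
    simpa [Prod.map_def] using h2
  rw [Kernel.map_apply _ measurable_nextQueue, Kernel.prod_apply, Kernel.prod_apply,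
    Kernel.const_apply, Kernel.id_apply, h, Measure.map_map measurable_nextQueue (by fun_prop)]
  rfl

/-- A steady-state law of the queue lengths: a stationary probability distribution of the chain. -/
structure IsSteadyState (sw : GeneralizedSwitch n M) (α : Measure (Fin n → ℝ))
    (sched : M → Kernel (Fin n → ℝ) (Fin n → ℝ)) (μ : Measure (Fin n → ℝ)) : Prop where
  prob : IsProbabilityMeasure μ
  invariant : Kernel.Invariant (sw.queueKernel α sched) μ

/-- `c`, `b` describe the capacity region with the minimum number of half-spaces, normalized so
that `c ℓ ≥ 0`, `‖c ℓ‖ = 1` (Euclidean norm) and `b ℓ > 0`. -/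
structure IsFacetDescription (sw : GeneralizedSwitch n M) {L : ℕ} (c : Fin L → Fin n → ℝ)
    (b : Fin L → ℝ) : Prop where
  eq_polyhedron : sw.capacityRegion = polyhedron c b
  minimal : ∀ (L' : ℕ) (c' : Fin L' → Fin n → ℝ) (b' : Fin L' → ℝ),
    sw.capacityRegion = polyhedron c' b' → L ≤ L'
  c_nonneg : ∀ ℓ i, 0 ≤ c ℓ i
  c_unit : ∀ ℓ, c ℓ ⬝ᵥ c ℓ = 1
  b_pos : ∀ ℓ, 0 < b ℓ

/-- The facet of the capacity region on the hyperplane `⟨c, x⟩ = b`. -/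
def facet (sw : GeneralizedSwitch n M) (c : Fin n → ℝ) (b : ℝ) : Set (Fin n → ℝ) :=
  {x | x ∈ sw.capacityRegion ∧ c ⬝ᵥ x = b}

/-- Indices of the facets that contain `ν`. -/
def activeFacets (sw : GeneralizedSwitch n M) {L : ℕ} (c : Fin L → Fin n → ℝ)
    (b : Fin L → ℝ) (ν : Fin n → ℝ) : Set (Fin L) :=
  {ℓ | ν ∈ sw.facet (c ℓ) (b ℓ)}

/-- The maximum `c`-weighted service rate available in channel state `m`. -/
noncomputable def maxRate (sw : GeneralizedSwitch n M) (c : Fin n → ℝ) (m : M) : ℝ :=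
  (sw.S m).sup' (sw.S_nonempty m) fun x => c ⬝ᵥ x

/-- Covariance matrix of the vector with entries `maxRate (c ℓ) m`, where `m` has law `ψ`. -/
noncomputable def covB (sw : GeneralizedSwitch n M) {L : ℕ} (c : Fin L → Fin n → ℝ) :
    Matrix (Fin L) (Fin L) ℝ :=
  Matrix.of fun k ℓ =>
    ∑ m, sw.ψ m * (sw.maxRate (c k) m * sw.maxRate (c ℓ) m) -
      (∑ m, sw.ψ m * sw.maxRate (c k) m) * ∑ m, sw.ψ m * sw.maxRate (c ℓ) m

end GeneralizedSwitch

/-! The test function is `q ⬝ᵥ H *ᵥ q`, the squared norm of the projection of the queue lengths onto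
the span of the active normals; its expected change over one slot is zero in steady state. Write `ν
= ∑ m, ψ m • y m` with `y m` in the convex hull of `S m`. Since `ν` lies on every active facet, each
`y m` of positive probability is optimal for every active normal, so `c ℓ ⬝ᵥ y m` is the value of
`B_ℓ` in state `m`. If the schedule were `y m` and no service were unused, the zero drift would read
`2ε 𝔼⟨q, Hν⟩ = 1ᵀ(H ∘ Σ_a)1 + 1ᵀ((CᵀC)⁻¹ ∘ Σ_B)1 + ε² ⟨ν, Hν⟩`. The proof shows that the true
dynamics differ from this by `O(√ε)`.

Two facts make the error small. The first is state space collapse: the distance `W` of the queue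
lengths from the cone `K` of active normals has second moment bounded uniformly for small `ε`
(`drift_sq_dist_cone`, `exists_state_space_collapse`). From `ν` the capacity region extends a fixed
length in every direction polar to `K`, so MaxWeight pushes `q` towards `K` at a fixed rate; a
third-power Lyapunov function turns this drift into the moment bound (`integrable_sq_of_drift`). The
second is that the total loss of weighted service, through suboptimal schedules and unused service,
is nonnegative with mean exactly `ε ∑ b ℓ`.

Pathwise, the error is at most a constant times `η W² + (1 + 1/η) · loss`, with `W²` taken before
and after the slot (`exists_drift_error_bound`). This uses three things: MaxWeight optimality
together with the positive gap between distinct schedule values, the complementarity of queue length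
and unused service, and the fact that `H` fixes `K`. Taking `η = √ε` gives `O(√ε)`, which becomes
`O(1/√ε)` after division by `2ε`. Finally `Hw = Hν` and `w - Hw` is orthogonal to `K`, so `⟨q, w⟩`
and `⟨q, Hν⟩` differ by `O(W q)`. -/

/-! ### Moment bounds from Lyapunov drift. -/

/-- Foster–Lyapunov comparison for an invariant probability measure, without any integrability
assumption on the Lyapunov function. -/
theorem lintegral_le_of_drift {X : Type*} [MeasurableSpace X] {κ : Kernel X X} {μ : Measure X}
    [IsProbabilityMeasure μ] [IsMarkovKernel κ] (hinv : Kernel.Invariant κ μ)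
    {V f : X → ℝ≥0∞} (hV : Measurable V) (hf : Measurable f) (hVtop : ∀ x, V x ≠ ∞) (b : ℝ≥0∞)
    (hdrift : ∀ᵐ x ∂μ, ∫⁻ y, V y ∂(κ x) + f x ≤ V x + b) :
    ∫⁻ x, f x ∂μ ≤ b := by
  have hN : ∀ N : ℕ, ∫⁻ x, ({x | V x ≤ N} : Set X).indicator f x ∂μ ≤ b := by
    intro N
    -- The truncation has a finite integral, so invariance lets it cancel from both sides even when
    -- `V` is not integrable.
    set VN : X → ℝ≥0∞ := fun x => min (V x) N with hVN
    have hVNm : Measurable VN := hV.min measurable_const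
    have hset : MeasurableSet {x | V x ≤ N} := measurableSet_le hV measurable_const
    have hfin : ∫⁻ x, VN x ∂μ ≠ ∞ := by
      refine ne_top_of_le_ne_top (b := (N : ℝ≥0∞)) (by simp) ?_
      calc ∫⁻ x, VN x ∂μ ≤ ∫⁻ _, (N : ℝ≥0∞) ∂μ := lintegral_mono fun x => min_le_right _ _
        _ = N := by simp
    have hint : ∫⁻ x, ∫⁻ y, VN y ∂(κ x) ∂μ = ∫⁻ x, VN x ∂μ := by
      conv_rhs => rw [← hinv.def]
      rw [Measure.lintegral_bind κ.measurable.aemeasurable hVNm.aemeasurable]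
    -- Truncation preserves the drift inequality: on `V x ≤ N` the left side only decreases, and on
    -- `V x > N` the bound `VN ≤ N` suffices because the indicator removes `f`.
    have hpt : ∀ᵐ x ∂μ, ∫⁻ y, VN y ∂(κ x) + ({x | V x ≤ N} : Set X).indicator f x ≤ VN x + b := by
      filter_upwards [hdrift] with x hx
      by_cases h : V x ≤ N
      · rw [Set.indicator_of_mem (by exact h), show VN x = V x from min_eq_left h]
        exact le_trans (by gcongr; exact min_le_left _ _) hx
      · rw [Set.indicator_of_notMem (by exact h), show VN x = N from min_eq_right (not_le.1 h).le,
          add_zero]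
        calc ∫⁻ y, VN y ∂(κ x) ≤ ∫⁻ _, (N : ℝ≥0∞) ∂(κ x) :=
              lintegral_mono fun x => min_le_right _ _
          _ = N := by simp
          _ ≤ N + b := le_self_add
    have h2 := lintegral_mono_ae hpt
    rw [lintegral_add_right _ (hf.indicator hset), lintegral_add_right _ measurable_const, hint] at h2
    simp only [lintegral_const, measure_univ, mul_one] at h2
    exact (ENNReal.add_le_add_iff_left hfin).1 h2
  have hmono : Monotone fun (N : ℕ) (x : X) => ({x | V x ≤ N} : Set X).indicator f x := by
    intro N N' h x
    refine Set.indicator_le_indicator_of_subset (fun y hy => ?_) (fun _ => zero_le) x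
    exact le_trans (show V y ≤ N from hy) (by exact_mod_cast h)
  have hsup : ∀ x, f x = ⨆ N : ℕ, ({x | V x ≤ N} : Set X).indicator f x := by
    intro x
    refine le_antisymm ?_ (iSup_le fun N => Set.indicator_le_self _ _ _)
    obtain ⟨N, hN⟩ := ENNReal.exists_nat_gt (hVtop x)
    refine le_trans ?_ (le_iSup _ N)
    rw [Set.indicator_of_mem (show x ∈ {x | V x ≤ N} from hN.le)]
  calc ∫⁻ x, f x ∂μ = ∫⁻ x, ⨆ N : ℕ, ({x | V x ≤ N} : Set X).indicator f x ∂μ :=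
        lintegral_congr hsup
    _ = ⨆ N : ℕ, ∫⁻ x, ({x | V x ≤ N} : Set X).indicator f x ∂μ :=
        lintegral_iSup (fun N => hf.indicator (measurableSet_le hV measurable_const)) hmono
    _ ≤ b := iSup_le hN

/-- Second moment bound for a Lyapunov function with bounded increments and negative drift. -/
theorem integrable_sq_of_drift {X : Type*} [MeasurableSpace X] {κ : Kernel X X} {μ : Measure X}
    [IsProbabilityMeasure μ] [IsMarkovKernel κ] (hinv : Kernel.Invariant κ μ)
    {W : X → ℝ} (hW : Measurable W) (hW0 : ∀ x, 0 ≤ W x) {D γ B : ℝ} (hD : 0 ≤ D) (hγ : 0 < γ)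
    (hB : 0 ≤ B)
    (hinc : ∀ᵐ x ∂μ, ∀ᵐ y ∂(κ x), |W y - W x| ≤ D)
    (hdrift : ∀ᵐ x ∂μ, ∫ y, W y ^ 2 ∂(κ x) ≤ W x ^ 2 - γ * W x + B) :
    Integrable (fun x => W x ^ 2) μ ∧
      ∫ x, W x ^ 2 ∂μ ≤ ((3 / 2 * B + 3 * D ^ 2) ^ 2 / (2 * γ) + D ^ 3) / γ := by
  set E : ℝ := 3 / 2 * B + 3 * D ^ 2 with hE
  set b : ℝ := E ^ 2 / (2 * γ) + D ^ 3 with hb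
  have hE0 : 0 ≤ E := by positivity
  have hb0 : 0 ≤ b := by positivity
  have key : ∫⁻ x, ENNReal.ofReal (γ * W x ^ 2) ∂μ ≤ ENNReal.ofReal b := by
    -- The cube has drift of order `-γ W ^ 2`, so comparison with it yields the second moment.
    refine lintegral_le_of_drift hinv (V := fun x => ENNReal.ofReal (W x ^ 3)) (by fun_prop)
      (by fun_prop) (fun _ => ENNReal.ofReal_ne_top) _ ?_
    filter_upwards [hinc, hdrift] with x hx hdx
    have hbd : ∀ᵐ y ∂(κ x), W y ≤ W x + D := by
      filter_upwards [hx] with y hy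
      linarith [(abs_le.1 hy).2]
    have hi2 : Integrable (fun y => W y ^ 2) (κ x) := by
      refine Integrable.of_bound (by fun_prop) ((W x + D) ^ 2) ?_
      filter_upwards [hbd] with y hy
      rw [Real.norm_of_nonneg (by positivity)]
      exact pow_le_pow_left₀ (hW0 y) hy 2
    have hi3 : Integrable (fun y => W y ^ 3) (κ x) := by
      refine Integrable.of_bound (by fun_prop) ((W x + D) ^ 3) ?_
      filter_upwards [hbd] with y hy
      rw [Real.norm_of_nonneg (pow_nonneg (hW0 y) 3)]
      exact pow_le_pow_left₀ (hW0 y) hy 3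
    -- With `t = W y - W x`, the combination `W y ^ 3 - 3 / 2 * W x * W y ^ 2` has no term linear in
    -- `t`. Only the drift of the square is therefore needed; the remaining terms `3 / 2 * W x * t ^
    -- 2 + t ^ 3` are bounded through `D`.
    have h3 : ∫ y, W y ^ 3 ∂(κ x) ≤
        ∫ y, (3 / 2 * W x * W y ^ 2 + (- (1 / 2) * W x ^ 3 + 3 * D ^ 2 * W x + D ^ 3)) ∂(κ x) := by
      refine integral_mono_ae hi3 ((hi2.const_mul _).add (integrable_const _)) ?_
      filter_upwards [hx] with y hy
      have h1 : (W y - W x) ^ 2 ≤ D ^ 2 := sq_le_sq' (by linarith [(abs_le.1 hy).1]) (abs_le.1 hy).2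
      have h2 : (W y - W x) ^ 3 ≤ D ^ 3 := by
        calc (W y - W x) ^ 3 ≤ |W y - W x| ^ 3 := by
              rw [← abs_pow]; exact le_abs_self _
          _ ≤ D ^ 3 := pow_le_pow_left₀ (abs_nonneg _) hy 3
      have h4 := mul_le_mul_of_nonneg_left h1 (hW0 x)
      have h5 := mul_nonneg (hW0 x) (sq_nonneg (W y - W x))
      nlinarith
    rw [integral_add (hi2.const_mul _) (integrable_const _), integral_const_mul,
      integral_const] at h3
    simp only [probReal_univ, one_smul] at h3
    have h6 : ∫ y, W y ^ 3 ∂(κ x) + γ * W x ^ 2 ≤ W x ^ 3 + b := by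
      have h7 := mul_le_mul_of_nonneg_left hdx (show 0 ≤ 3 / 2 * W x by linarith [hW0 x])
      -- The linear term is absorbed by part of the available `3 / 2 * γ * W x ^ 2`, leaving at
      -- least `γ * W x ^ 2`.
      have h8 : E * W x ≤ γ / 2 * W x ^ 2 + E ^ 2 / (2 * γ) := by
        have : γ / 2 * W x ^ 2 + E ^ 2 / (2 * γ) - E * W x = (γ * W x - E) ^ 2 / (2 * γ) := by
          field_simp; ring
        have : 0 ≤ (γ * W x - E) ^ 2 / (2 * γ) := by positivity
        linarith
      have h9 : 3 / 2 * W x * (W x ^ 2 - γ * W x + B) + (- (1 / 2) * W x ^ 3 + 3 * D ^ 2 * W x + D ^ 3)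
        = W x ^ 3 - 3 / 2 * γ * W x ^ 2 + E * W x + D ^ 3 := by rw [hE]; ring
      linarith
    rw [← ofReal_integral_eq_lintegral_ofReal hi3 (ae_of_all _ fun y => pow_nonneg (hW0 y) 3),
      ← ENNReal.ofReal_add (integral_nonneg fun y => pow_nonneg (hW0 y) 3) (by positivity),
      ← ENNReal.ofReal_add (pow_nonneg (hW0 x) 3) hb0]
    exact ENNReal.ofReal_le_ofReal h6
  have hint : Integrable (fun x => γ * W x ^ 2) μ := by
    refine ⟨by fun_prop, ?_⟩
    rw [hasFiniteIntegral_iff_ofReal (ae_of_all _ fun x => by positivity)]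
    exact lt_of_le_of_lt key ENNReal.ofReal_lt_top
  have hint' : Integrable (fun x => W x ^ 2) μ := by
    have := hint.const_mul γ⁻¹
    simpa [← mul_assoc, inv_mul_cancel₀ hγ.ne'] using this
  refine ⟨hint', ?_⟩
  rw [← ofReal_integral_eq_lintegral_ofReal hint (ae_of_all _ fun x => by positivity),
    ENNReal.ofReal_le_ofReal_iff hb0, integral_const_mul] at key
  rw [le_div_iff₀ hγ]
  linarith

/-! ### Metric projection onto a closed convex cone. -/

/-- `W` is the Euclidean distance to the cone `K` and `p` the nearest point of `K`, in terms of dot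
products. -/
structure IsConeProjection {n : ℕ} (K : Set (Fin n → ℝ)) (W : (Fin n → ℝ) → ℝ)
    (p : (Fin n → ℝ) → Fin n → ℝ) : Prop where
  continuous : Continuous W
  nonneg : ∀ q, 0 ≤ W q
  mem : ∀ q, p q ∈ K
  sq_eq : ∀ q, W q ^ 2 = (q - p q) ⬝ᵥ (q - p q)
  sq_le : ∀ q, ∀ k ∈ K, W q ^ 2 ≤ (q - k) ⬝ᵥ (q - k)
  orthogonal : ∀ q, (q - p q) ⬝ᵥ p q = 0
  polar : ∀ q, ∀ k ∈ K, (q - p q) ⬝ᵥ k ≤ 0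
  lipschitz : ∀ q r, |W r - W q| ≤ √((r - q) ⬝ᵥ (r - q))

/-- A nearest point exists because `K` is closed. Moving it by `t • k`, which stays in the cone,
gives polarity; shrinking it by the factor `1 - t` gives the missing half of orthogonality. The
lemma works in `EuclideanSpace` because the norm on `Fin n → ℝ` is the sup norm. -/
theorem exists_isConeProjection {n : ℕ} {K : Set (Fin n → ℝ)} (hcl : IsClosed K)
    (hconv : Convex ℝ K) (h0 : 0 ∈ K) (hsmul : ∀ t : ℝ, 0 ≤ t → ∀ k ∈ K, t • k ∈ K) :
    ∃ (W : (Fin n → ℝ) → ℝ) (p : (Fin n → ℝ) → Fin n → ℝ), IsConeProjection K W p := by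
  let K' : Set (EuclideanSpace ℝ (Fin n)) := WithLp.ofLp ⁻¹' K
  have hcl' : IsClosed K' := hcl.preimage (PiLp.continuous_ofLp 2 _)
  have hne : K'.Nonempty := ⟨0, h0⟩
  have hnorm : ∀ v : Fin n → ℝ, ‖WithLp.toLp 2 v‖ ^ 2 = v ⬝ᵥ v := fun v => by
    rw [EuclideanSpace.norm_sq_eq]
    simp [dotProduct, sq]
  have hdist : ∀ u v : Fin n → ℝ, dist (WithLp.toLp 2 u) (WithLp.toLp 2 v) ^ 2 =
      (u - v) ⬝ᵥ (u - v) := fun u v => by rw [dist_eq_norm, ← WithLp.toLp_sub, hnorm]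
  choose p' hp'K hp' using fun q : Fin n → ℝ =>
    hcl'.exists_infDist_eq_dist hne (WithLp.toLp 2 q)
  have hmin : ∀ q : Fin n → ℝ, ∀ k ∈ K, Metric.infDist (WithLp.toLp 2 q) K' ^ 2 ≤
      (q - k) ⬝ᵥ (q - k) := fun q k hk => by
    rw [← hdist]
    exact pow_le_pow_left₀ Metric.infDist_nonneg
      (Metric.infDist_le_dist_of_mem (show WithLp.toLp 2 k ∈ K' from hk)) 2
  have heq : ∀ q : Fin n → ℝ, Metric.infDist (WithLp.toLp 2 q) K' ^ 2 =
      (q - (p' q).ofLp) ⬝ᵥ (q - (p' q).ofLp) := fun q => by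
    rw [← hdist, hp']
  have hadd : ∀ k ∈ K, ∀ l ∈ K, k + l ∈ K := fun k hk l hl => by
    have := hsmul 2 (by norm_num) _
      (hconv hk hl (show (0 : ℝ) ≤ 1 / 2 by norm_num) (show (0 : ℝ) ≤ 1 / 2 by norm_num)
        (by norm_num))
    simpa [smul_smul] using this
  -- first order optimality conditions
  have hquad : ∀ x y : ℝ, 0 ≤ y → (∀ t : ℝ, 0 < t → t ≤ 1 → 2 * t * x ≤ t ^ 2 * y) → x ≤ 0 := by
    intro x y hy h
    by_contra hx
    push Not at hx
    -- This `t` satisfies `t * (y + 1) ≤ x`, so `t ^ 2 * y < t * x`, which contradicts the assumed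
    -- inequality when `x > 0`.
    have h1 := h (min 1 (x / (y + 1))) (by positivity) (min_le_left _ _)
    set t := min 1 (x / (y + 1)) with ht
    have ht0 : 0 < t := by positivity
    have h2 : t * (y + 1) ≤ x := by
      have := min_le_right 1 (x / (y + 1))
      rwa [← ht, le_div_iff₀ (by positivity)] at this
    nlinarith
  have hpol : ∀ q : Fin n → ℝ, ∀ k ∈ K, (q - (p' q).ofLp) ⬝ᵥ k ≤ 0 := by
    intro q k hk
    refine hquad _ (k ⬝ᵥ k) (by rw [← hnorm]; positivity) fun t ht _ => ?_
    have h := hmin q _ (hadd _ (hp'K q) _ (hsmul t ht.le k hk))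
    rw [heq] at h
    have : (q - ((p' q).ofLp + t • k)) = (q - (p' q).ofLp) - t • k := by abel
    rw [this] at h
    generalize q - (p' q).ofLp = r at h ⊢
    rw [sub_dotProduct, dotProduct_sub, dotProduct_sub] at h
    simp only [smul_dotProduct, dotProduct_smul, smul_eq_mul] at h
    rw [dotProduct_comm k r] at h
    nlinarith
  refine ⟨fun q => Metric.infDist (WithLp.toLp 2 q) K', fun q => (p' q).ofLp, ?_,
    fun q => Metric.infDist_nonneg, hp'K, heq, hmin, fun q => le_antisymm (hpol q _ (hp'K q)) ?_,
    hpol, ?_⟩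
  · exact (Metric.continuous_infDist_pt _).comp (PiLp.continuous_toLp 2 _)
  · rw [← neg_nonpos]
    refine hquad _ ((p' q).ofLp ⬝ᵥ (p' q).ofLp) (by rw [← hnorm]; positivity) fun t ht ht1 => ?_
    have h := hmin q _ (hsmul (1 - t) (by linarith) _ (hp'K q))
    rw [heq] at h
    have : (q - (1 - t) • (p' q).ofLp) = (q - (p' q).ofLp) + t • (p' q).ofLp := by
      rw [sub_smul, one_smul]; abel
    rw [this] at h
    generalize q - (p' q).ofLp = r at h ⊢
    rw [add_dotProduct, dotProduct_add, dotProduct_add] at h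
    simp only [smul_dotProduct, dotProduct_smul, smul_eq_mul] at h
    rw [dotProduct_comm (p' q).ofLp r] at h
    nlinarith
  · intro q r
    rw [← hdist, Real.sqrt_sq dist_nonneg, ← Real.dist_eq]
    exact (Metric.lipschitz_infDist_pt K').dist_le_mul _ _ |>.trans (by simp)

/-! ### Elementary bounds for dot products. -/

theorem abs_apply_le_of_dotProduct_self {n : ℕ} {v : Fin n → ℝ} {t : ℝ} (ht : 0 ≤ t)
    (h : v ⬝ᵥ v ≤ t ^ 2) (i : Fin n) : |v i| ≤ t := by
  refine abs_le_of_sq_le_sq ?_ ht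
  refine le_trans ?_ h
  rw [sq]
  exact Finset.single_le_sum (f := fun i => v i * v i) (fun i _ => mul_self_nonneg _)
    (Finset.mem_univ i)

theorem dotProduct_le_of_dotProduct_self {n : ℕ} {u v : Fin n → ℝ} {t r : ℝ} (ht : 0 ≤ t)
    (hr : 0 ≤ r) (hu : u ⬝ᵥ u ≤ t ^ 2) (hv : v ⬝ᵥ v ≤ r ^ 2) : u ⬝ᵥ v ≤ t * r := by
  refine le_of_sq_le_sq ?_ (mul_nonneg ht hr)
  have h := Finset.sum_mul_sq_le_sq_mul_sq Finset.univ u v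
  simp only [dotProduct, ← sq] at hu hv
  calc (u ⬝ᵥ v) ^ 2 ≤ (∑ i, u i ^ 2) * ∑ i, v i ^ 2 := h
    _ ≤ t ^ 2 * r ^ 2 := mul_le_mul hu hv (Finset.sum_nonneg fun i _ => sq_nonneg _) (sq_nonneg _)
    _ = (t * r) ^ 2 := by ring

theorem dotProduct_self_le_of_abs_le {n : ℕ} {v : Fin n → ℝ} {t : ℝ} (h : ∀ i, |v i| ≤ t) :
    v ⬝ᵥ v ≤ n * t ^ 2 := by
  calc v ⬝ᵥ v ≤ ∑ _i : Fin n, t ^ 2 := Finset.sum_le_sum fun i _ => by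
        rw [← sq]; exact sq_le_sq' (abs_le.1 (h i)).1 (abs_le.1 (h i)).2
    _ = n * t ^ 2 := by simp

/-! ### Expectations bundled with integrability. -/

/-- `f` is integrable with integral `c`. -/
def HasMean {Ω : Type*} [MeasurableSpace Ω] (P : Measure Ω) (f : Ω → ℝ) (c : ℝ) : Prop :=
  Integrable f P ∧ ∫ ω, f ω ∂P = c

namespace HasMean

variable {Ω : Type*} [MeasurableSpace Ω] {P : Measure Ω} {f g : Ω → ℝ} {c d : ℝ}

theorem of_integrable (hf : Integrable f P) : HasMean P f (∫ ω, f ω ∂P) := ⟨hf, rfl⟩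

theorem const [IsProbabilityMeasure P] (c : ℝ) : HasMean P (fun _ => c) c :=
  ⟨integrable_const c, by simp⟩

theorem add (hf : HasMean P f c) (hg : HasMean P g d) :
    HasMean P (fun ω => f ω + g ω) (c + d) :=
  ⟨hf.1.add hg.1, by rw [integral_add hf.1 hg.1, hf.2, hg.2]⟩

theorem sub (hf : HasMean P f c) (hg : HasMean P g d) :
    HasMean P (fun ω => f ω - g ω) (c - d) :=
  ⟨hf.1.sub hg.1, by rw [integral_sub hf.1 hg.1, hf.2, hg.2]⟩

theorem const_mul (r : ℝ) (hf : HasMean P f c) :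
    HasMean P (fun ω => r * f ω) (r * c) :=
  ⟨hf.1.const_mul r, by rw [integral_const_mul, hf.2]⟩

theorem sum {ι : Type*} {s : Finset ι} {f : ι → Ω → ℝ} {c : ι → ℝ}
    (h : ∀ i ∈ s, HasMean P (f i) (c i)) :
    HasMean P (fun ω => ∑ i ∈ s, f i ω) (∑ i ∈ s, c i) :=
  ⟨integrable_finsetSum _ fun i hi => (h i hi).1, by
    rw [integral_finsetSum _ fun i hi => (h i hi).1]
    exact Finset.sum_congr rfl fun i hi => (h i hi).2⟩

theorem mono (hf : HasMean P f c) (hg : HasMean P g d) (h : ∀ᵐ ω ∂P, f ω ≤ g ω) :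
    c ≤ d := by
  rw [← hf.2, ← hg.2]
  exact integral_mono_ae hf.1 hg.1 h

end HasMean

/-! ### One time slot realized on a probability space. -/

namespace GeneralizedSwitch

variable {n : ℕ} {M : Type*} [Fintype M]

/-- The random variables `m`, `q`, `s`, `a` describe the channel state, the queue lengths, the
selected schedule and the arrivals in one time slot of the switch under MaxWeight. -/
structure IsStep (sw : GeneralizedSwitch n M) (α : Measure (Fin n → ℝ)) {Ω : Type*}
    [MeasurableSpace Ω] (P : Measure Ω) (m : Ω → M) (q s a : Ω → Fin n → ℝ) : Prop where
  prob : IsProbabilityMeasure P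
  measurable_q : Measurable q
  measurable_s : Measurable s
  measurable_a : Measurable a
  measurable_m : ∀ g : M → ℝ, Measurable fun ω => g (m ω)
  argmax : ∀ᵐ ω ∂P, s ω ∈ sw.maxWeightSchedules (m ω) (q ω)
  pos_m : ∀ᵐ ω ∂P, 0 < sw.ψ (m ω)
  law_a : P.map a = α
  indep_q_a : IndepFun q a P
  indep_m_a : ∀ g : M → ℝ, IndepFun (fun ω => g (m ω)) a P
  indep_m_q : ∀ g : M → ℝ, IndepFun (fun ω => g (m ω)) q P
  integral_m : ∀ g : M → ℝ, ∫ ω, g (m ω) ∂P = ∑ k, sw.ψ k * g k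

/-- The law of the channel state. -/
noncomputable def channelLaw (sw : GeneralizedSwitch n M) [MeasurableSpace M] : Measure M :=
  ∑ m, ENNReal.ofReal (sw.ψ m) • Measure.dirac m

theorem isProbabilityMeasure_channelLaw (sw : GeneralizedSwitch n M) [MeasurableSpace M] :
    IsProbabilityMeasure sw.channelLaw := by
  constructor
  simp only [channelLaw, Measure.finsetSum_apply, Measure.smul_apply, measure_univ, smul_eq_mul,
    mul_one]
  rw [← ENNReal.ofReal_sum_of_nonneg fun m _ => sw.ψ_mem.1 m, sw.ψ_mem.2, ENNReal.ofReal_one]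

theorem isMarkovKernel_queueKernel (sw : GeneralizedSwitch n M) (α : Measure (Fin n → ℝ))
    [IsProbabilityMeasure α] (sched : M → Kernel (Fin n → ℝ) (Fin n → ℝ))
    [∀ m, IsMarkovKernel (sched m)] : IsMarkovKernel (sw.queueKernel α sched) := by
  refine ⟨fun q => ⟨?_⟩⟩
  have hm : Measurable fun p : (Fin n → ℝ) × (Fin n → ℝ) => nextQueue q p.1 p.2 :=
    measurable_nextQueue.comp (f := fun p : (Fin n → ℝ) × (Fin n → ℝ) => ((q, p.1), p.2))
      (by fun_prop)
  rw [queueKernel_apply]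
  simp only [Measure.finsetSum_apply, Measure.smul_apply, smul_eq_mul]
  simp only [Measure.map_apply hm MeasurableSet.univ, Set.preimage_univ, measure_univ, mul_one]
  rw [← ENNReal.ofReal_sum_of_nonneg fun m _ => sw.ψ_mem.1 m, sw.ψ_mem.2, ENNReal.ofReal_one]

theorem measurableSet_maxWeightSchedules (sw : GeneralizedSwitch n M) (m : M) :
    MeasurableSet {p : (Fin n → ℝ) × (Fin n → ℝ) | p.2 ∈ sw.maxWeightSchedules m p.1} := by
  have : {p : (Fin n → ℝ) × (Fin n → ℝ) | p.2 ∈ sw.maxWeightSchedules m p.1} =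
      (Prod.snd ⁻¹' (sw.S m : Set (Fin n → ℝ))) ∩
        ⋂ x ∈ sw.S m, {p : (Fin n → ℝ) × (Fin n → ℝ) | p.1 ⬝ᵥ x ≤ p.1 ⬝ᵥ p.2} := by
    ext p; simp [maxWeightSchedules]
  rw [this]
  refine (measurable_snd (sw.S m).finite_toSet.measurableSet).inter
    (Finset.measurableSet_biInter _ fun x _ => measurableSet_le ?_ ?_)
  · unfold dotProduct; fun_prop
  · unfold dotProduct; fun_prop

/-- One time slot of the switch, started from queue lengths with law `μ`. -/
theorem exists_isStep.{u} {M : Type u} [Fintype M] (sw : GeneralizedSwitch n M)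
    (α : Measure (Fin n → ℝ)) [IsProbabilityMeasure α]
    {sched : M → Kernel (Fin n → ℝ) (Fin n → ℝ)} (hsched : sw.IsMaxWeight sched)
    (μ : Measure (Fin n → ℝ)) [IsProbabilityMeasure μ] :
    ∃ (Ω : Type u) (_ : MeasurableSpace Ω) (P : Measure Ω) (m : Ω → M) (q s a : Ω → Fin n → ℝ),
      sw.IsStep α P m q s a ∧ P.map q = μ ∧
        P.map (fun ω => nextQueue (q ω) (s ω) (a ω)) = μ.bind (sw.queueKernel α sched) := by
  let _ : MeasurableSpace M := ⊤
  have := sw.isProbabilityMeasure_channelLaw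
  have := hsched.markov
  let κs : Kernel (M × (Fin n → ℝ)) (Fin n → ℝ) :=
    ⟨fun x => sched x.1 x.2, measurable_from_prod_countable_right fun m => (sched m).measurable⟩
  have hκs : ∀ x, κs x = sched x.1 x.2 := fun _ => rfl
  have : IsMarkovKernel κs := ⟨fun x => by rw [hκs]; infer_instance⟩
  -- The coordinates are channel state, queue lengths, schedule and arrivals. Channel and queues
  -- form a product, the schedule is drawn by a kernel from both, and the arrivals are a further
  -- product factor; all required independences come from this layout.
  let Q : Measure ((M × (Fin n → ℝ)) × (Fin n → ℝ)) := (sw.channelLaw.prod μ) ⊗ₘ κs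
  have hQfst : Q.map Prod.fst = sw.channelLaw.prod μ := Measure.fst_compProd _ _
  let P : Measure (((M × (Fin n → ℝ)) × (Fin n → ℝ)) × (Fin n → ℝ)) := Q.prod α
  have hPfst : P.map Prod.fst = Q := by
    change (Q.prod α).map Prod.fst = Q
    rw [Measure.map_fst_prod, measure_univ, one_smul]
  have hPmq : P.map (fun ω => ω.1.1) = sw.channelLaw.prod μ := by
    rw [← hQfst, ← hPfst, Measure.map_map measurable_fst measurable_fst]; rfl
  have hPq : P.map (fun ω => ω.1.1.2) = μ := by
    have : μ = (sw.channelLaw.prod μ).map Prod.snd := by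
      rw [Measure.map_snd_prod, measure_univ, one_smul]
    conv_rhs => rw [this, ← hPmq, Measure.map_map measurable_snd (by fun_prop)]
    rfl
  have hPm : P.map (fun ω => ω.1.1.1) = sw.channelLaw := by
    have : sw.channelLaw = (sw.channelLaw.prod μ).map Prod.fst := by
      rw [Measure.map_fst_prod, measure_univ, one_smul]
    rw [this, ← hPmq, Measure.map_map measurable_fst (by fun_prop)]
    rfl
  have hindep : IndepFun (Prod.fst : (((M × (Fin n → ℝ)) × (Fin n → ℝ)) × (Fin n → ℝ)) → _)
      Prod.snd P := indepFun_prod (X := id) (Y := id) measurable_id measurable_id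
  have hg : ∀ g : M → ℝ, Measurable g := fun g => measurable_from_top
  refine ⟨_, inferInstance, P, fun ω => ω.1.1.1, fun ω => ω.1.1.2, fun ω => ω.1.2, fun ω => ω.2,
    ⟨inferInstance, by fun_prop, by fun_prop, by fun_prop, fun g => (hg g).comp (by fun_prop),
      ?_, ?_, ?_, ?_, ?_, ?_, ?_⟩, hPq, ?_⟩
  · have hset : MeasurableSet {x : (M × (Fin n → ℝ)) × (Fin n → ℝ) |
        x.2 ∈ sw.maxWeightSchedules x.1.1 x.1.2} := by
      have : {x : (M × (Fin n → ℝ)) × (Fin n → ℝ) | x.2 ∈ sw.maxWeightSchedules x.1.1 x.1.2} =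
          ⋃ m, ((fun x : (M × (Fin n → ℝ)) × (Fin n → ℝ) => x.1.1) ⁻¹' {m}) ∩
            ((fun x : (M × (Fin n → ℝ)) × (Fin n → ℝ) => (x.1.2, x.2)) ⁻¹'
              {p | p.2 ∈ sw.maxWeightSchedules m p.1}) := by
        ext x; simp
      rw [this]
      refine MeasurableSet.iUnion fun m => MeasurableSet.inter ?_ ?_
      · exact (show Measurable fun x : (M × (Fin n → ℝ)) × (Fin n → ℝ) => x.1.1 by fun_prop)
          (MeasurableSet.of_discrete)
      · exact (show Measurable fun x : (M × (Fin n → ℝ)) × (Fin n → ℝ) => (x.1.2, x.2) by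
          fun_prop) (sw.measurableSet_maxWeightSchedules m)
    have hQ : ∀ᵐ x ∂Q, x.2 ∈ sw.maxWeightSchedules x.1.1 x.1.2 := by
      rw [Measure.ae_compProd_iff hset]
      exact ae_of_all _ fun x => hsched.argmax x.1 x.2
    rw [← hPfst] at hQ
    exact ae_of_ae_map measurable_fst.aemeasurable hQ
  · have : ∀ᵐ x ∂sw.channelLaw, 0 < sw.ψ x := by
      rw [ae_iff, channelLaw, Measure.finsetSum_apply]
      refine Finset.sum_eq_zero fun m _ => ?_
      rw [Measure.smul_apply, Measure.dirac_apply]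
      by_cases h : 0 < sw.ψ m
      · simp [h]
      · simp [ENNReal.ofReal_of_nonpos (not_lt.1 h)]
    rw [← hPm] at this
    exact ae_of_ae_map (f := fun ω : (((M × (Fin n → ℝ)) × (Fin n → ℝ)) × (Fin n → ℝ)) => ω.1.1.1)
      (by fun_prop) this
  · change (Q.prod α).map Prod.snd = α
    rw [Measure.map_snd_prod, measure_univ, one_smul]
  · exact hindep.comp (φ := fun x => x.1.2) (ψ := id) (by fun_prop) measurable_id
  · exact fun g => hindep.comp (φ := fun x : (M × (Fin n → ℝ)) × (Fin n → ℝ) => g x.1.1) (ψ := id)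
      ((hg g).comp (by fun_prop)) measurable_id
  · intro g
    have h1 : IndepFun (fun x : M × (Fin n → ℝ) => g x.1) (fun x => x.2) (sw.channelLaw.prod μ) :=
      indepFun_prod (X := g) (Y := id) (hg g) measurable_id
    rw [← hPmq] at h1
    rw [indepFun_iff_measure_inter_preimage_eq_mul] at h1 ⊢
    intro A B hA hB
    have h2 := h1 A B hA hB
    have hm1 : Measurable fun x : M × (Fin n → ℝ) => g x.1 := (hg g).comp measurable_fst
    rwa [Measure.map_apply (by fun_prop) ((hm1 hA).inter (measurable_snd hB)),
      Measure.map_apply (by fun_prop) (hm1 hA),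
      Measure.map_apply (by fun_prop) (measurable_snd hB)] at h2
  · intro g
    have h1 : ∫ ω, g ω.1.1.1 ∂P = ∫ x, g x ∂(P.map (fun ω => ω.1.1.1)) :=
      (integral_map (by fun_prop) (hg g).aestronglyMeasurable).symm
    rw [h1, hPm, channelLaw, integral_finsetSum_measure fun m _ => Integrable.smul_measure
      (integrable_dirac (by simp)) ENNReal.ofReal_ne_top]
    refine Finset.sum_congr rfl fun m _ => ?_
    rw [integral_smul_measure, integral_dirac, ENNReal.toReal_ofReal (sw.ψ_mem.1 m), smul_eq_mul]
  · have hnm : Measurable fun ω : (((M × (Fin n → ℝ)) × (Fin n → ℝ)) × (Fin n → ℝ)) =>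
        nextQueue ω.1.1.2 ω.1.2 ω.2 :=
      measurable_nextQueue.comp (f := fun ω : (((M × (Fin n → ℝ)) × (Fin n → ℝ)) × (Fin n → ℝ)) =>
        ((ω.1.1.2, ω.1.2), ω.2)) (by fun_prop)
    ext A hA
    rw [Measure.bind_apply hA (sw.queueKernel α sched).measurable.aemeasurable,
      ← lintegral_indicator_one hA, lintegral_map (measurable_one.indicator hA) hnm]
    have hF : Measurable fun ω : (((M × (Fin n → ℝ)) × (Fin n → ℝ)) × (Fin n → ℝ)) =>
        A.indicator (1 : (Fin n → ℝ) → ℝ≥0∞) (nextQueue ω.1.1.2 ω.1.2 ω.2) :=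
      (measurable_one.indicator hA).comp hnm
    change ∫⁻ ω, _ ∂(Q.prod α) = _
    rw [lintegral_prod _ hF.aemeasurable]
    change ∫⁻ ω, _ ∂((sw.channelLaw.prod μ) ⊗ₘ κs) = _
    have hF2 := hF.lintegral_prod_right' (ν := α)
    rw [Measure.lintegral_compProd hF2]
    have hF3 := hF2.lintegral_kernel_prod_right' (κ := κs)
    rw [lintegral_prod _ hF3.aemeasurable, channelLaw, lintegral_finsetSum_measure]
    simp only [lintegral_smul_measure, lintegral_dirac, smul_eq_mul, hκs]
    simp only [queueKernel_apply, Measure.finsetSum_apply, Measure.smul_apply, smul_eq_mul]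
    have hterm : ∀ (m : M) (q : Fin n → ℝ),
        (((sched m q).prod α).map (fun p => nextQueue q p.1 p.2)) A =
        ∫⁻ s, ∫⁻ a, A.indicator (1 : (Fin n → ℝ) → ℝ≥0∞) (nextQueue q s a) ∂α ∂(sched m q) := by
      intro m q
      have hm : Measurable fun p : (Fin n → ℝ) × (Fin n → ℝ) => nextQueue q p.1 p.2 :=
        measurable_nextQueue.comp (f := fun p : (Fin n → ℝ) × (Fin n → ℝ) => ((q, p.1), p.2))
          (by fun_prop)
      rw [← lintegral_indicator_one hA, lintegral_map (measurable_one.indicator hA) hm]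
      exact lintegral_prod _ ((measurable_one.indicator hA).comp hm).aemeasurable
    simp only [hterm]
    have hF4 : ∀ m : M, Measurable fun q =>
        ∫⁻ s, ∫⁻ a, A.indicator (1 : (Fin n → ℝ) → ℝ≥0∞) (nextQueue q s a) ∂α ∂(sched m q) := fun m =>
      hF3.comp (f := fun q : Fin n → ℝ => (m, q)) (by fun_prop)
    rw [lintegral_finsetSum _ fun m _ => (hF4 m).const_mul _]
    refine Finset.sum_congr rfl fun m _ => ?_
    rw [lintegral_const_mul _ (hF4 m)]

end GeneralizedSwitch

/-! ### The queue recursion in one coordinate. -/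

section Queue

variable {n : ℕ} {q s a : Fin n → ℝ} {R : ℝ} {i : Fin n}

theorem nextQueue_eq_max (q s a : Fin n → ℝ) (i : Fin n) :
    nextQueue q s a i = max (q i + a i - s i) 0 := by
  simp only [nextQueue, unusedService, Pi.add_apply, Pi.sub_apply]
  rcases le_total (s i) (q i + a i) with h | h
  · rw [max_eq_right (by linarith), max_eq_left (by linarith)]; ring
  · rw [max_eq_left (by linarith), max_eq_right (by linarith)]; ring

theorem nextQueue_nonneg (q s a : Fin n → ℝ) (i : Fin n) : 0 ≤ nextQueue q s a i := by
  rw [nextQueue_eq_max]; exact le_max_right _ _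

theorem unusedService_nonneg (q s a : Fin n → ℝ) (i : Fin n) : 0 ≤ unusedService q s a i :=
  le_max_right _ _

/-- Complementarity: service is wasted only in a queue that ends the slot empty. This removes the
identity part of the cross term between next queue lengths and unused service. -/
theorem nextQueue_mul_unusedService (q s a : Fin n → ℝ) (i : Fin n) :
    nextQueue q s a i * unusedService q s a i = 0 := by
  rw [nextQueue_eq_max]
  simp only [unusedService]
  rcases le_total (s i) (q i + a i) with h | h
  · rw [max_eq_right (a := s i - (q i + a i)) (by linarith), mul_zero]
  · rw [max_eq_right (by linarith), zero_mul]

theorem unusedService_le (hq : 0 ≤ q i) (ha : 0 ≤ a i) (hs : 0 ≤ s i) (hsR : s i ≤ R) :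
    unusedService q s a i ≤ R :=
  max_le (by linarith) (by linarith)

theorem abs_nextQueue_sub_le (hq : 0 ≤ q i) (ha : 0 ≤ a i) (haR : a i ≤ R) (hs : 0 ≤ s i)
    (hsR : s i ≤ R) : |nextQueue q s a i - q i| ≤ R := by
  rw [nextQueue_eq_max, abs_le]
  rcases max_cases (q i + a i - s i) 0 with h | h <;> constructor <;> linarith

/-- The bound is independent of the queue length, since service is wasted only when `q i + a i < s i
≤ R`. -/
theorem mul_unusedService_le (hq : 0 ≤ q i) (ha : 0 ≤ a i) (hs : 0 ≤ s i) (hsR : s i ≤ R) :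
    q i * unusedService q s a i ≤ R ^ 2 := by
  rcases le_total (s i) (q i + a i) with h | h
  · have : unusedService q s a i = 0 := max_eq_right (by linarith)
    rw [this, mul_zero]; positivity
  · calc q i * unusedService q s a i ≤ R * R :=
          mul_le_mul (by linarith) (unusedService_le hq ha hs hsR) (unusedService_nonneg _ _ _ _)
            (by linarith)
      _ = R ^ 2 := by ring

theorem nextQueue_sub_eq (q s a : Fin n → ℝ) :
    nextQueue q s a - q = a - s + unusedService q s a := by
  unfold nextQueue; abel

end Queue

/-! ### Support functions of the capacity region. -/

namespace GeneralizedSwitch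

variable {n : ℕ} {M : Type*} [Fintype M] (sw : GeneralizedSwitch n M)

theorem exists_rate_bound : ∃ R : ℝ, 0 ≤ R ∧ ∀ m, ∀ x ∈ sw.S m, ∀ i, x i ≤ R := by
  refine ⟨∑ m, ∑ x ∈ sw.S m, ∑ i, x i, ?_, fun m x hx i => ?_⟩
  · exact Finset.sum_nonneg fun m _ => Finset.sum_nonneg fun x hx =>
      Finset.sum_nonneg fun i _ => sw.S_nonneg m x hx i
  · calc x i ≤ ∑ i, x i := Finset.single_le_sum (f := fun i => x i)
          (fun i _ => sw.S_nonneg m x hx i) (Finset.mem_univ i)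
      _ ≤ ∑ x ∈ sw.S m, ∑ i, x i := Finset.single_le_sum (f := fun x : Fin n → ℝ => ∑ i, x i)
          (fun x hx => Finset.sum_nonneg fun i _ => sw.S_nonneg m x hx i) hx
      _ ≤ _ := Finset.single_le_sum (f := fun m => ∑ x ∈ sw.S m, ∑ i, x i)
          (fun m _ => Finset.sum_nonneg fun x hx =>
            Finset.sum_nonneg fun i _ => sw.S_nonneg m x hx i) (Finset.mem_univ m)

variable {sw}

theorem dotProduct_le_of_mem_convexHull {m : M} {q y : Fin n → ℝ} {t : ℝ}
    (hy : y ∈ convexHull ℝ (sw.S m : Set (Fin n → ℝ))) (h : ∀ x ∈ sw.S m, q ⬝ᵥ x ≤ t) :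
    q ⬝ᵥ y ≤ t := by
  have hlin : IsLinearMap ℝ fun x : Fin n → ℝ => q ⬝ᵥ x :=
    ⟨fun x y => dotProduct_add _ _ _, fun r x => dotProduct_smul _ _ _⟩
  exact convexHull_min (t := {x | q ⬝ᵥ x ≤ t}) (fun x hx => h x hx)
    (convex_halfSpace_le hlin t) hy

theorem nonneg_of_mem_convexHull {m : M} {y : Fin n → ℝ}
    (hy : y ∈ convexHull ℝ (sw.S m : Set (Fin n → ℝ))) (i : Fin n) : 0 ≤ y i := by
  have := dotProduct_le_of_mem_convexHull (q := -Pi.single i 1) (t := 0) hy fun x hx => by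
    simpa using sw.S_nonneg m x hx i
  simpa using this

theorem le_of_mem_convexHull {m : M} {y : Fin n → ℝ} {R : ℝ}
    (hR : ∀ x ∈ sw.S m, ∀ i, x i ≤ R)
    (hy : y ∈ convexHull ℝ (sw.S m : Set (Fin n → ℝ))) (i : Fin n) : y i ≤ R := by
  have := dotProduct_le_of_mem_convexHull (q := Pi.single i 1) (t := R) hy fun x hx => by
    simpa using hR x hx i
  simpa using this

theorem dotProduct_le_maxRate {m : M} (k : Fin n → ℝ) {x : Fin n → ℝ} (hx : x ∈ sw.S m) :
    k ⬝ᵥ x ≤ sw.maxRate k m :=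
  Finset.le_sup' (fun x => k ⬝ᵥ x) hx

/-- The support function of a Minkowski sum is the sum of the support functions: a maximizer can be
chosen in each channel state separately. -/
theorem exists_mem_capacityRegion_eq_maxRate (k : Fin n → ℝ) :
    ∃ x ∈ sw.capacityRegion, k ⬝ᵥ x = ∑ m, sw.ψ m * sw.maxRate k m := by
  choose y hy hyk using fun m =>
    Finset.exists_mem_eq_sup' (sw.S_nonempty m) fun x => k ⬝ᵥ x
  refine ⟨∑ m, sw.ψ m • y m, ⟨y, fun m => subset_convexHull ℝ _ (hy m), rfl⟩, ?_⟩
  rw [dotProduct_sum]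
  refine Finset.sum_congr rfl fun m _ => ?_
  rw [dotProduct_smul, smul_eq_mul, maxRate, hyk]

theorem sum_maxRate_le {k : Fin n → ℝ} {t : ℝ} (h : ∀ x ∈ sw.capacityRegion, k ⬝ᵥ x ≤ t) :
    ∑ m, sw.ψ m * sw.maxRate k m ≤ t := by
  obtain ⟨x, hx, hxk⟩ := sw.exists_mem_capacityRegion_eq_maxRate k
  exact hxk ▸ h x hx

/-- If `∑ m, ψ m • y m` lies on a supporting hyperplane of the capacity region, then each `y m` is
optimal in the channel state `m`. -/
theorem dotProduct_eq_maxRate_of_supporting {y : M → Fin n → ℝ}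
    (hy : ∀ m, y m ∈ convexHull ℝ (sw.S m : Set (Fin n → ℝ))) {k : Fin n → ℝ}
    (hk : ∀ x ∈ sw.capacityRegion, k ⬝ᵥ x ≤ k ⬝ᵥ ∑ m, sw.ψ m • y m) {m : M}
    (hm : 0 < sw.ψ m) : k ⬝ᵥ y m = sw.maxRate k m := by
  have h1 := sum_maxRate_le hk
  have hle : ∀ m, k ⬝ᵥ y m ≤ sw.maxRate k m := fun m =>
    dotProduct_le_of_mem_convexHull (hy m) fun x hx => dotProduct_le_maxRate k hx
  have h2 : k ⬝ᵥ ∑ m, sw.ψ m • y m = ∑ m, sw.ψ m * (k ⬝ᵥ y m) := by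
    rw [dotProduct_sum]
    exact Finset.sum_congr rfl fun m _ => by rw [dotProduct_smul, smul_eq_mul]
  have h3 : ∀ m ∈ Finset.univ, sw.ψ m * (k ⬝ᵥ y m) ≤ sw.ψ m * sw.maxRate k m := fun m _ =>
    mul_le_mul_of_nonneg_left (hle m) (sw.ψ_mem.1 m)
  -- The averages agree while the inequality holds state by state, so equality holds in each state.
  have h4 := (Finset.sum_eq_sum_iff_of_le h3).1 (le_antisymm (Finset.sum_le_sum h3) (h2 ▸ h1)) m
    (Finset.mem_univ m)
  exact mul_left_cancel₀ hm.ne' h4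

end GeneralizedSwitch

/-! ### Drift towards a cone of normals. -/

namespace GeneralizedSwitch

variable {n : ℕ} {M : Type*} [Fintype M] {sw : GeneralizedSwitch n M} {α : Measure (Fin n → ℝ)}
  {Amax R : ℝ} {lam : Fin n → ℝ}

namespace IsStep

variable {Ω : Type*} [MeasurableSpace Ω] {P : Measure Ω} {m : Ω → M} {q s a : Ω → Fin n → ℝ}

theorem ae_arrival (h : sw.IsStep α P m q s a) (hα : IsArrivalLaw α Amax lam) :
    ∀ᵐ ω ∂P, ∀ i, 0 ≤ a ω i ∧ a ω i ≤ Amax := by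
  have := hα.bounded
  rw [← h.law_a] at this
  exact ae_of_ae_map h.measurable_a.aemeasurable this

theorem integral_arrival (h : sw.IsStep α P m q s a) (hα : IsArrivalLaw α Amax lam) (i : Fin n) :
    ∫ ω, a ω i ∂P = lam i := by
  rw [← hα.mean i, ← h.law_a, integral_map h.measurable_a.aemeasurable
    (measurable_pi_apply i).aestronglyMeasurable]

theorem integrable_arrival (h : sw.IsStep α P m q s a) (hα : IsArrivalLaw α Amax lam)
    (i : Fin n) : Integrable (fun ω => a ω i) P := by
  have := h.prob
  have := h.measurable_a
  refine Integrable.of_bound (by fun_prop) Amax ?_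
  filter_upwards [h.ae_arrival hα] with ω hω
  rw [Real.norm_of_nonneg (hω i).1]
  exact (hω i).2

theorem integrable_channel (h : sw.IsStep α P m q s a) (g : M → ℝ) :
    Integrable (fun ω => g (m ω)) P := by
  have := h.prob
  refine Integrable.of_bound (h.measurable_m g).aestronglyMeasurable (∑ k, |g k|) ?_
  exact ae_of_all _ fun ω => Finset.single_le_sum (f := fun k => |g k|)
    (fun k _ => abs_nonneg _) (Finset.mem_univ (m ω))

theorem measurable_next (h : sw.IsStep α P m q s a) :
    Measurable fun ω => nextQueue (q ω) (s ω) (a ω) :=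
  measurable_nextQueue.comp (f := fun ω => ((q ω, s ω), a ω))
    ((h.measurable_q.prodMk h.measurable_s).prodMk h.measurable_a)

end IsStep

/-- Any law after one step is carried by the orthant, and a stationary law is its own law after one
step. -/
theorem IsSteadyState.ae_nonneg [IsProbabilityMeasure α]
    {sched : M → Kernel (Fin n → ℝ) (Fin n → ℝ)} (hsched : sw.IsMaxWeight sched)
    {μ : Measure (Fin n → ℝ)} (hμ : sw.IsSteadyState α sched μ) : ∀ᵐ q ∂μ, ∀ i, 0 ≤ q i := by
  have := hμ.prob
  obtain ⟨Ω, _, P, m, q, s, a, h, -, hnext⟩ := sw.exists_isStep α hsched μ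
  rw [hμ.invariant.def] at hnext
  rw [← hnext, ae_map_iff h.measurable_next.aemeasurable]
  · exact ae_of_all _ fun ω i => nextQueue_nonneg _ _ _ i
  · have : {q : Fin n → ℝ | ∀ i, 0 ≤ q i} = ⋂ i, {q | 0 ≤ q i} := by ext; simp
    rw [this]
    exact MeasurableSet.iInter fun i => measurableSet_le measurable_const (measurable_pi_apply i)

/-- One-step drift of the squared distance of the queue lengths from a cone `K` of vectors that are
normal to the capacity region at `x₀`. -/
theorem drift_sq_dist_cone [IsProbabilityMeasure α]
    {sched : M → Kernel (Fin n → ℝ) (Fin n → ℝ)} (hsched : sw.IsMaxWeight sched)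
    (hα : IsArrivalLaw α Amax lam) (hAR : Amax ≤ R) (hR : ∀ m, ∀ x ∈ sw.S m, ∀ i, x i ≤ R)
    {K : Set (Fin n → ℝ)} {W : (Fin n → ℝ) → ℝ} {p : (Fin n → ℝ) → Fin n → ℝ}
    (hK : IsConeProjection K W p) (hKnn : ∀ k ∈ K, ∀ i, 0 ≤ k i) {x₀ : Fin n → ℝ}
    (hsupp : ∀ k ∈ K, ∀ x ∈ sw.capacityRegion, k ⬝ᵥ x ≤ k ⬝ᵥ x₀) {δ : ℝ} (hδ : 0 ≤ δ)
    (hball : ∀ v : Fin n → ℝ, v ⬝ᵥ v ≤ 1 → (∀ k ∈ K, v ⬝ᵥ k ≤ 0) → x₀ + δ • v ∈ sw.capacityRegion)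
    (hlam : (lam - x₀) ⬝ᵥ (lam - x₀) ≤ (δ / 2) ^ 2) {q₀ : Fin n → ℝ} (hq₀ : ∀ i, 0 ≤ q₀ i) :
    (∀ᵐ r ∂(sw.queueKernel α sched q₀), |W r - W q₀| ≤ √(n * R ^ 2)) ∧
      ∫ r, W r ^ 2 ∂(sw.queueKernel α sched q₀) ≤ W q₀ ^ 2 - δ * W q₀ + 3 * (n * R ^ 2) := by
  obtain ⟨Ω, _, P, m, q, s, a, h, hq, hnext⟩ := sw.exists_isStep α hsched (Measure.dirac q₀)
  rw [Measure.dirac_bind (sw.queueKernel α sched).measurable] at hnext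
  have := h.prob
  have hW := hK.continuous.measurable
  have hqq : ∀ᵐ ω ∂P, q ω = q₀ := by
    have h1 : ∀ᵐ r ∂(P.map q), r = q₀ := by
      rw [hq]
      exact (ae_dirac_iff (measurableSet_singleton q₀)).2 rfl
    exact ae_of_ae_map h.measurable_q.aemeasurable h1
  have hinc : ∀ᵐ ω ∂P, |W (nextQueue (q ω) (s ω) (a ω)) - W q₀| ≤ √(n * R ^ 2) := by
    filter_upwards [hqq, h.argmax, h.ae_arrival hα] with ω h1 h2 h3
    rw [h1]
    refine (hK.lipschitz _ _).trans (Real.sqrt_le_sqrt (dotProduct_self_le_of_abs_le fun i => ?_))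
    exact abs_nextQueue_sub_le (hq₀ i) (h3 i).1 ((h3 i).2.trans hAR) (sw.S_nonneg _ _ h2.1 i)
      (hR _ _ h2.1 i)
  set r := q₀ - p q₀ with hr
  -- The unit direction from the cone to `q₀`. If `W q₀ = 0`, the inverse is zero and `v = 0`, which
  -- the argument tolerates.
  set v := (W q₀)⁻¹ • r with hv
  have hWi : (W q₀)⁻¹ * W q₀ ^ 2 = W q₀ := by
    rcases eq_or_ne (W q₀) 0 with h0 | h0
    · simp [h0]
    · field_simp
  have hrr : r ⬝ᵥ r = W q₀ ^ 2 := (hK.sq_eq q₀).symm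
  have hqv : q₀ ⬝ᵥ v = W q₀ := by
    have h1 : q₀ ⬝ᵥ r = r ⬝ᵥ r := by
      have h2 : r ⬝ᵥ p q₀ = 0 := hK.orthogonal q₀
      have h3 : r ⬝ᵥ r = r ⬝ᵥ q₀ - r ⬝ᵥ p q₀ := by rw [← dotProduct_sub]
      rw [h3, h2, sub_zero, dotProduct_comm]
    rw [hv, dotProduct_smul, h1, hrr, smul_eq_mul, hWi]
  -- The point `x₀ + δ • v` is feasible on average. MaxWeight earns at least as much `q₀`-weight as
  -- its component `y k` in each state, and this is the source of the drift `-δ * W q₀`.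
  obtain ⟨y, hy, hyx⟩ := hball v (by
      rw [hv, dotProduct_smul, smul_dotProduct, hrr, smul_eq_mul, smul_eq_mul, hWi]
      exact inv_mul_le_one) (fun k hk => by
      rw [hv, smul_dotProduct, smul_eq_mul]
      exact mul_nonpos_of_nonneg_of_nonpos (inv_nonneg.2 (hK.nonneg _)) (hK.polar _ k hk))
  let g : M → ℝ := fun k => q₀ ⬝ᵥ y k - sw.maxRate (p q₀) k
  have hg : r ⬝ᵥ x₀ + δ * W q₀ ≤ ∑ k, sw.ψ k * g k := by
    have h1 : ∑ k, sw.ψ k * g k = q₀ ⬝ᵥ (x₀ + δ • v) - ∑ k, sw.ψ k * sw.maxRate (p q₀) k := by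
      rw [hyx, dotProduct_sum, ← Finset.sum_sub_distrib]
      refine Finset.sum_congr rfl fun k _ => ?_
      rw [dotProduct_smul, smul_eq_mul, ← mul_sub]
    have h2 := sum_maxRate_le (sw := sw) (hsupp _ (hK.mem q₀))
    rw [h1, dotProduct_add, dotProduct_smul, hqv, smul_eq_mul, hr, sub_dotProduct]
    linarith
  have hpath : ∀ᵐ ω ∂P, W (nextQueue (q ω) (s ω) (a ω)) ^ 2 ≤
      W q₀ ^ 2 + 3 * (n * R ^ 2) + 2 * ∑ i, r i * a ω i - 2 * g (m ω) := by
    filter_upwards [hqq, h.argmax, h.ae_arrival hα] with ω h1 h2 h3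
    rw [h1] at h2 ⊢
    have hs0 := sw.S_nonneg _ _ h2.1
    have hsR := hR _ _ h2.1
    set u := unusedService q₀ (s ω) (a ω) with hu
    have e1 : nextQueue q₀ (s ω) (a ω) - p q₀ = r + (nextQueue q₀ (s ω) (a ω) - q₀) := by
      rw [hr]; abel
    have hΔ : (nextQueue q₀ (s ω) (a ω) - q₀) ⬝ᵥ (nextQueue q₀ (s ω) (a ω) - q₀) ≤ n * R ^ 2 :=
      dotProduct_self_le_of_abs_le fun i => abs_nextQueue_sub_le (hq₀ i) (h3 i).1
        ((h3 i).2.trans hAR) (hs0 i) (hsR i)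
    -- Unused service cannot push far outwards: `p q₀ ⬝ᵥ u` is nonnegative, and `q₀ ⬝ᵥ u` is bounded
    -- coordinatewise.
    have hru : r ⬝ᵥ u ≤ n * R ^ 2 := by
      have hpu : 0 ≤ p q₀ ⬝ᵥ u := Finset.sum_nonneg fun i _ =>
        mul_nonneg (hKnn _ (hK.mem q₀) i) (unusedService_nonneg _ _ _ i)
      have hqu : q₀ ⬝ᵥ u ≤ n * R ^ 2 := by
        calc q₀ ⬝ᵥ u ≤ ∑ _i : Fin n, R ^ 2 := Finset.sum_le_sum fun i _ =>
              mul_unusedService_le (hq₀ i) (h3 i).1 (hs0 i) (hsR i)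
          _ = n * R ^ 2 := by simp
      rw [hr, sub_dotProduct]; linarith
    -- Since `r = q₀ - p q₀`, the MaxWeight lower bound for `q₀ ⬝ᵥ s` combines with the upper bound
    -- `maxRate` for `p q₀ ⬝ᵥ s`.
    have hrs : g (m ω) ≤ r ⬝ᵥ s ω := by
      have i1 := dotProduct_le_of_mem_convexHull (hy (m ω)) h2.2
      have i2 := dotProduct_le_maxRate (p q₀) h2.1
      rw [hr, sub_dotProduct]
      change q₀ ⬝ᵥ y (m ω) - sw.maxRate (p q₀) (m ω) ≤ _
      linarith
    -- The old projection `p q₀` serves as a competitor for the distance of the new queue lengths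
    -- from `K`. The constant `3 * (n * R ^ 2)` is one part squared increment and two parts `2 * (r
    -- ⬝ᵥ u)`.
    have h4 := hK.sq_le (nextQueue q₀ (s ω) (a ω)) _ (hK.mem q₀)
    rw [e1, add_dotProduct, dotProduct_add, dotProduct_add, hrr,
      dotProduct_comm (nextQueue q₀ (s ω) (a ω) - q₀) r] at h4
    have h5 : r ⬝ᵥ (nextQueue q₀ (s ω) (a ω) - q₀) = ∑ i, r i * a ω i - r ⬝ᵥ s ω + r ⬝ᵥ u := by
      rw [nextQueue_sub_eq, dotProduct_add, dotProduct_sub]; rfl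
    rw [h5] at h4
    linarith
  constructor
  · rw [← hnext, ae_map_iff h.measurable_next.aemeasurable
      (measurableSet_le (by fun_prop) measurable_const)]
    exact hinc
  · rw [← hnext, integral_map h.measurable_next.aemeasurable (by fun_prop)]
    have hmeas := h.measurable_next
    have hint : Integrable (fun ω => W (nextQueue (q ω) (s ω) (a ω)) ^ 2) P := by
      refine Integrable.of_bound ((hW.comp hmeas).pow_const 2).aestronglyMeasurable
        ((W q₀ + √(n * R ^ 2)) ^ 2) ?_
      filter_upwards [hinc] with ω hω
      rw [Real.norm_of_nonneg (by positivity)]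
      exact pow_le_pow_left₀ (hK.nonneg _) (by linarith [(abs_le.1 hω).2]) 2
    have hia : HasMean P (fun ω => ∑ i, r i * a ω i) (r ⬝ᵥ lam) := HasMean.sum fun i _ =>
      HasMean.const_mul _ ⟨h.integrable_arrival hα i, h.integral_arrival hα i⟩
    have h7 := HasMean.mono (HasMean.of_integrable hint) (((HasMean.const _).add
      (hia.const_mul _)).sub (HasMean.const_mul _ ⟨h.integrable_channel g, h.integral_m g⟩)) hpath
    -- The shift of the mean from `x₀` to `lam` costs half of the drift `-2 * δ * W q₀`.
    have h6 : r ⬝ᵥ (lam - x₀) ≤ W q₀ * (δ / 2) :=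
      dotProduct_le_of_dotProduct_self (hK.nonneg _) (by linarith) hrr.le hlam
    rw [dotProduct_sub] at h6
    linarith

/-- Second moment of the distance of the queue lengths from a cone in steady state. -/
theorem IsSteadyState.sq_dist_cone [IsProbabilityMeasure α]
    {sched : M → Kernel (Fin n → ℝ) (Fin n → ℝ)} (hsched : sw.IsMaxWeight sched)
    {μ : Measure (Fin n → ℝ)} (hμ : sw.IsSteadyState α sched μ)
    (hα : IsArrivalLaw α Amax lam) (hAR : Amax ≤ R) (hR : ∀ m, ∀ x ∈ sw.S m, ∀ i, x i ≤ R)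
    {K : Set (Fin n → ℝ)} {W : (Fin n → ℝ) → ℝ} {p : (Fin n → ℝ) → Fin n → ℝ}
    (hK : IsConeProjection K W p) (hKnn : ∀ k ∈ K, ∀ i, 0 ≤ k i) {x₀ : Fin n → ℝ}
    (hsupp : ∀ k ∈ K, ∀ x ∈ sw.capacityRegion, k ⬝ᵥ x ≤ k ⬝ᵥ x₀) {δ : ℝ} (hδ : 0 < δ)
    (hball : ∀ v : Fin n → ℝ, v ⬝ᵥ v ≤ 1 → (∀ k ∈ K, v ⬝ᵥ k ≤ 0) → x₀ + δ • v ∈ sw.capacityRegion)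
    (hlam : (lam - x₀) ⬝ᵥ (lam - x₀) ≤ (δ / 2) ^ 2) :
    Integrable (fun q => W q ^ 2) μ ∧ ∫ q, W q ^ 2 ∂μ ≤
      ((3 / 2 * (3 * (n * R ^ 2)) + 3 * √(n * R ^ 2) ^ 2) ^ 2 / (2 * δ) + √(n * R ^ 2) ^ 3) / δ := by
  have := hμ.prob
  have := hsched.markov
  have := sw.isMarkovKernel_queueKernel α sched
  have hd : ∀ᵐ q ∂μ, _ := (hμ.ae_nonneg hsched).mono fun q hq =>
    drift_sq_dist_cone hsched hα hAR hR hK hKnn hsupp hδ.le hball hlam hq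
  exact integrable_sq_of_drift hμ.invariant hK.continuous.measurable hK.nonneg
    (Real.sqrt_nonneg _) hδ (by positivity) (hd.mono fun _ h => h.1) (hd.mono fun _ h => h.2)

end GeneralizedSwitch

/-! ### The cone of active normals and the projection onto their span. -/

/-- The bipolar of the vectors `c ℓ`, `ℓ ∈ A`, i.e. the closed convex cone that they generate. -/
def bipolarCone {n L : ℕ} (c : Fin L → Fin n → ℝ) (A : Set (Fin L)) : Set (Fin n → ℝ) :=
  {k | ∀ v : Fin n → ℝ, (∀ ℓ ∈ A, c ℓ ⬝ᵥ v ≤ 0) → v ⬝ᵥ k ≤ 0}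

section Cone

variable {n L : ℕ} {c : Fin L → Fin n → ℝ} {A : Set (Fin L)}

theorem exists_isConeProjection_bipolarCone (c : Fin L → Fin n → ℝ) (A : Set (Fin L)) :
    ∃ W p, IsConeProjection (bipolarCone c A) W p := by
  have h : bipolarCone c A = ⋂ v : {v : Fin n → ℝ // ∀ ℓ ∈ A, c ℓ ⬝ᵥ v ≤ 0},
      {k | v.1 ⬝ᵥ k ≤ 0} := by
    ext k; simp [bipolarCone]
  refine exists_isConeProjection ?_ ?_ ?_ ?_
  · rw [h]
    exact isClosed_iInter fun v => isClosed_le (by unfold dotProduct; fun_prop) continuous_const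
  · rw [h]
    exact convex_iInter fun v => convex_halfSpace_le
      ⟨fun x y => dotProduct_add _ _ _, fun r x => dotProduct_smul _ _ _⟩ 0
  · intro v _
    simp
  · intro t ht k hk v hv
    rw [dotProduct_smul, smul_eq_mul]
    exact mul_nonpos_of_nonneg_of_nonpos ht (hk v hv)

theorem mem_bipolarCone {ℓ : Fin L} (hℓ : ℓ ∈ A) : c ℓ ∈ bipolarCone c A := fun v hv => by
  rw [dotProduct_comm]; exact hv ℓ hℓ

theorem nonneg_of_mem_bipolarCone (hc : ∀ ℓ i, 0 ≤ c ℓ i) {k : Fin n → ℝ}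
    (hk : k ∈ bipolarCone c A) (i : Fin n) : 0 ≤ k i := by
  have := hk (-Pi.single i 1) fun ℓ _ => by simpa using hc ℓ i
  simpa using this

end Cone

section Projection

variable {n L : ℕ} {c : Fin L → Fin n → ℝ} {T : Finset (Fin L)}

theorem transpose_colMatrix_mulVec (c : Fin L → Fin n → ℝ) (T : Finset (Fin L)) (x : Fin n → ℝ)
    (ℓ : T) : ((colMatrix c T)ᵀ *ᵥ x) ℓ = c ℓ ⬝ᵥ x := rfl

/-- `x ⬝ᵥ CᵀC *ᵥ x` is the squared length of `C *ᵥ x`, so the Gram matrix has the same trivial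
kernel as `C`. -/
theorem isUnit_gram (hT : LinearIndependent ℝ (fun ℓ : T => c ℓ)) :
    IsUnit ((colMatrix c T)ᵀ * colMatrix c T).det := by
  rw [← Matrix.isUnit_iff_isUnit_det, ← Matrix.mulVec_injective_iff_isUnit]
  have h1 : Function.Injective (colMatrix c T).mulVec := by
    rw [Matrix.mulVec_injective_iff]
    exact hT
  have key : ∀ x : T → ℝ, ((colMatrix c T)ᵀ * colMatrix c T) *ᵥ x = 0 → x = 0 := by
    intro x hx
    apply h1
    rw [Matrix.mulVec_zero]
    have h2 : (colMatrix c T *ᵥ x) ⬝ᵥ (colMatrix c T *ᵥ x) = 0 := by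
      rw [Matrix.dotProduct_mulVec, ← Matrix.mulVec_transpose, Matrix.mulVec_mulVec, hx,
        zero_dotProduct]
    exact dotProduct_self_eq_zero.1 h2
  intro x y hxy
  have := key (x - y) (by rw [Matrix.mulVec_sub]; exact sub_eq_zero.2 hxy)
  exact sub_eq_zero.1 this

/-- The projection matrix onto the column space of `C`. -/
noncomputable def projMatrix (c : Fin L → Fin n → ℝ) (T : Finset (Fin L)) :
    Matrix (Fin n) (Fin n) ℝ :=
  colMatrix c T * ((colMatrix c T)ᵀ * colMatrix c T)⁻¹ * (colMatrix c T)ᵀ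

theorem transpose_projMatrix (c : Fin L → Fin n → ℝ) (T : Finset (Fin L)) :
    (projMatrix c T)ᵀ = projMatrix c T := by
  simp [projMatrix, Matrix.transpose_mul, Matrix.transpose_nonsing_inv, Matrix.mul_assoc]

theorem dotProduct_projMatrix_mulVec_comm (x y : Fin n → ℝ) :
    x ⬝ᵥ projMatrix c T *ᵥ y = y ⬝ᵥ projMatrix c T *ᵥ x := by
  rw [Matrix.dotProduct_mulVec, ← Matrix.mulVec_transpose, transpose_projMatrix, dotProduct_comm]

theorem dotProduct_projMatrix_mulVec (x y : Fin n → ℝ) :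
    x ⬝ᵥ projMatrix c T *ᵥ y = ((colMatrix c T)ᵀ *ᵥ x) ⬝ᵥ
      (((colMatrix c T)ᵀ * colMatrix c T)⁻¹ *ᵥ ((colMatrix c T)ᵀ *ᵥ y)) := by
  rw [projMatrix, ← Matrix.mulVec_mulVec, ← Matrix.mulVec_mulVec, Matrix.dotProduct_mulVec,
    ← Matrix.mulVec_transpose]

theorem transpose_colMatrix_mulVec_projMatrix (hT : LinearIndependent ℝ (fun ℓ : T => c ℓ))
    (x : Fin n → ℝ) :
    (colMatrix c T)ᵀ *ᵥ (projMatrix c T *ᵥ x) = (colMatrix c T)ᵀ *ᵥ x := by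
  rw [Matrix.mulVec_mulVec, projMatrix, ← Matrix.mul_assoc, ← Matrix.mul_assoc,
    Matrix.mul_nonsing_inv _ (isUnit_gram hT), Matrix.one_mul]

theorem exists_abs_mulVec_le {ι κ : Type*} [Fintype ι] [Fintype κ] (A : Matrix ι κ ℝ) :
    ∃ C : ℝ, 0 ≤ C ∧ ∀ (v : κ → ℝ) (t : ℝ), 0 ≤ t → (∀ j, |v j| ≤ t) →
      ∀ i, |(A *ᵥ v) i| ≤ C * t := by
  refine ⟨∑ i, ∑ j, |A i j|, Finset.sum_nonneg fun i _ => Finset.sum_nonneg fun j _ =>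
    abs_nonneg _, fun v t ht hv i => ?_⟩
  calc |(A *ᵥ v) i| ≤ ∑ j, |A i j * v j| := Finset.abs_sum_le_sum_abs _ _
    _ ≤ ∑ j, |A i j| * t := Finset.sum_le_sum fun j _ => by
        rw [abs_mul]; exact mul_le_mul_of_nonneg_left (hv j) (abs_nonneg _)
    _ = (∑ j, |A i j|) * t := by rw [Finset.sum_mul]
    _ ≤ _ := mul_le_mul_of_nonneg_right (Finset.single_le_sum (f := fun i => ∑ j, |A i j|)
        (fun i _ => Finset.sum_nonneg fun j _ => abs_nonneg _) (Finset.mem_univ i)) ht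

/-- The projection factors through `Cᵀ`, so it sees `v` only through the numbers `c ℓ ⬝ᵥ v`. For
service losses, these are what the mean identity controls. -/
theorem exists_abs_projMatrix_mulVec_le (c : Fin L → Fin n → ℝ) (T : Finset (Fin L)) :
    ∃ C : ℝ, 0 ≤ C ∧ ∀ (v : Fin n → ℝ) (i : Fin n),
      |(projMatrix c T *ᵥ v) i| ≤ C * ∑ ℓ ∈ T, |c ℓ ⬝ᵥ v| := by
  obtain ⟨C, hC0, hC⟩ := exists_abs_mulVec_le
    (colMatrix c T * ((colMatrix c T)ᵀ * colMatrix c T)⁻¹)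
  refine ⟨C, hC0, fun v i => ?_⟩
  rw [projMatrix, ← Matrix.mulVec_mulVec]
  exact hC _ _ (Finset.sum_nonneg fun ℓ _ => abs_nonneg _) (fun ℓ => by
    rw [transpose_colMatrix_mulVec]
    exact Finset.single_le_sum (f := fun ℓ => |c ℓ ⬝ᵥ v|) (fun ℓ _ => abs_nonneg _) ℓ.2) i

theorem projMatrix_mulVec_eq_zero {v : Fin n → ℝ} (h : ∀ ℓ ∈ T, c ℓ ⬝ᵥ v = 0) :
    projMatrix c T *ᵥ v = 0 := by
  have : (colMatrix c T)ᵀ *ᵥ v = 0 := by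
    ext ℓ
    exact h ℓ ℓ.2
  rw [projMatrix, ← Matrix.mulVec_mulVec, this, Matrix.mulVec_zero]

/-- The residual `v = k - Hk` is orthogonal to all `c ℓ` with `ℓ ∈ T`, hence by the span condition
to all with `ℓ ∈ A`. Both `v` and `-v` then test the bipolar condition, so `v ⬝ᵥ k = 0` and `v = 0`.
With the cone defined as a bipolar, no Farkas lemma is needed. -/
theorem projMatrix_mulVec_of_mem_bipolarCone (hT : LinearIndependent ℝ (fun ℓ : T => c ℓ))
    {A : Set (Fin L)} (hspan : Submodule.span ℝ (c '' T) = Submodule.span ℝ (c '' A))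
    {k : Fin n → ℝ} (hk : k ∈ bipolarCone c A) : projMatrix c T *ᵥ k = k := by
  set v := k - projMatrix c T *ᵥ k with hv
  have h1 : (colMatrix c T)ᵀ *ᵥ v = 0 := by
    rw [hv, Matrix.mulVec_sub, transpose_colMatrix_mulVec_projMatrix hT, sub_self]
  have h2 : ∀ ℓ ∈ T, c ℓ ⬝ᵥ v = 0 := fun ℓ hℓ => by
    have := congrFun h1 ⟨ℓ, hℓ⟩
    rwa [transpose_colMatrix_mulVec] at this
  have h3 : ∀ x ∈ Submodule.span ℝ (c '' T), x ⬝ᵥ v = 0 := by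
    intro x hx
    induction hx using Submodule.span_induction with
    | mem x hx => obtain ⟨ℓ, hℓ, rfl⟩ := hx; exact h2 ℓ hℓ
    | zero => exact zero_dotProduct _
    | add x y _ _ hx hy => rw [add_dotProduct, hx, hy, add_zero]
    | smul r x _ hx => rw [smul_dotProduct, hx, smul_zero]
  have h4 : ∀ ℓ ∈ A, c ℓ ⬝ᵥ v = 0 := fun ℓ hℓ =>
    h3 _ (hspan ▸ Submodule.subset_span (Set.mem_image_of_mem c hℓ))
  have h5 : v ⬝ᵥ k = 0 := by
    refine le_antisymm (hk v fun ℓ hℓ => (h4 ℓ hℓ).le) ?_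
    have := hk (-v) fun ℓ hℓ => by rw [dotProduct_neg, h4 ℓ hℓ, neg_zero]
    rw [neg_dotProduct] at this
    linarith
  have h6 : v ⬝ᵥ v = 0 := by
    have h7 : v ⬝ᵥ projMatrix c T *ᵥ k = 0 := by
      rw [dotProduct_projMatrix_mulVec_comm, projMatrix_mulVec_eq_zero h2, dotProduct_zero]
    have h8 : v ⬝ᵥ v = v ⬝ᵥ k - v ⬝ᵥ projMatrix c T *ᵥ k := by
      rw [← dotProduct_sub]
    rw [h8, h5, h7, sub_zero]
  exact (sub_eq_zero.1 (dotProduct_self_eq_zero.1 h6)).symm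

theorem hadamardSum_eq {ι : Type*} [Fintype ι] (A B : Matrix ι ι ℝ) :
    hadamardSum A B = ∑ i, ∑ j, A i j * B i j := by
  simp [hadamardSum, dotProduct, Matrix.mulVec]

theorem dotProduct_mulVec_eq_sum {ι : Type*} [Fintype ι] (A : Matrix ι ι ℝ) (x y : ι → ℝ) :
    x ⬝ᵥ A *ᵥ y = ∑ i, ∑ j, A i j * (x i * y j) := by
  simp only [dotProduct, Matrix.mulVec, Finset.mul_sum]
  exact Finset.sum_congr rfl fun i _ => Finset.sum_congr rfl fun j _ => by ring

end Projection

/-! ### Local geometry at `ν` and state space collapse. -/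

namespace GeneralizedSwitch

variable {n : ℕ} {M : Type*} [Fintype M] {sw : GeneralizedSwitch n M} {L : ℕ}
  {c : Fin L → Fin n → ℝ} {b : Fin L → ℝ} {ν : Fin n → ℝ}

theorem IsFacetDescription.mem_iff (hcb : sw.IsFacetDescription c b) {x : Fin n → ℝ} :
    x ∈ sw.capacityRegion ↔ (∀ i, 0 ≤ x i) ∧ ∀ ℓ, c ℓ ⬝ᵥ x ≤ b ℓ := by
  rw [hcb.eq_polyhedron]; rfl

theorem IsFacetDescription.isClosed (hcb : sw.IsFacetDescription c b) :
    IsClosed sw.capacityRegion := by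
  have : sw.capacityRegion = (⋂ i, {x : Fin n → ℝ | 0 ≤ x i}) ∩ ⋂ ℓ, {x | c ℓ ⬝ᵥ x ≤ b ℓ} := by
    ext x; simp [hcb.mem_iff]
  rw [this]
  refine (isClosed_iInter fun i => isClosed_le continuous_const (continuous_apply i)).inter
    (isClosed_iInter fun ℓ => isClosed_le ?_ continuous_const)
  unfold dotProduct; fun_prop

theorem exists_ball_subset_of_mem_interior {C : Set (Fin n → ℝ)} {x : Fin n → ℝ}
    (hx : x ∈ interior C) :
    ∃ δ : ℝ, 0 < δ ∧ ∀ v : Fin n → ℝ, v ⬝ᵥ v ≤ 1 → x + δ • v ∈ C := by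
  obtain ⟨r, hr, hball⟩ := Metric.mem_nhds_iff.1 (mem_interior_iff_mem_nhds.1 hx)
  refine ⟨r / 2, by positivity, fun v hv => hball ?_⟩
  rw [Metric.mem_ball, dist_eq_norm, add_sub_cancel_left, norm_smul, Real.norm_of_nonneg (by positivity)]
  have : ‖v‖ ≤ 1 := (pi_norm_le_iff_of_nonneg zero_le_one).2 fun i =>
    abs_apply_le_of_dotProduct_self zero_le_one (by simpa using hv) i
  nlinarith

theorem IsFacetDescription.pos_of_mem_interior (hcb : sw.IsFacetDescription c b)
    {x : Fin n → ℝ} (hx : x ∈ interior sw.capacityRegion) (i : Fin n) : 0 < x i := by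
  obtain ⟨δ, hδ, h⟩ := exists_ball_subset_of_mem_interior hx
  have := (hcb.mem_iff.1 (h (-Pi.single i 1) (by simp))).1 i
  simp at this
  linarith

/-- The capacity region contains a uniform segment from `ν` in every direction that is polar to
the normals of the facets through `ν`. -/
theorem IsFacetDescription.exists_polar_ball (hcb : sw.IsFacetDescription c b)
    (hν : ν ∈ sw.capacityRegion) (hpos : ∀ i, 0 < ν i) :
    ∃ δ : ℝ, 0 < δ ∧ ∀ v : Fin n → ℝ, v ⬝ᵥ v ≤ 1 →
      (∀ ℓ ∈ sw.activeFacets c b ν, v ⬝ᵥ c ℓ ≤ 0) → ν + δ • v ∈ sw.capacityRegion := by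
  -- `δ` is at most every coordinate of `ν` and every slack of an inactive facet; active facets
  -- impose nothing in polar directions.
  have h1 : ∀ᶠ δ : ℝ in 𝓝[>] 0, ∀ i, δ ≤ ν i := eventually_all.2 fun i =>
    eventually_nhdsWithin_of_eventually_nhds (Iic_mem_nhds (hpos i))
  have h2 : ∀ᶠ δ : ℝ in 𝓝[>] 0, ∀ ℓ, c ℓ ⬝ᵥ ν < b ℓ → δ ≤ b ℓ - c ℓ ⬝ᵥ ν := by
    refine eventually_all.2 fun ℓ => ?_
    by_cases h : c ℓ ⬝ᵥ ν < b ℓ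
    · filter_upwards [eventually_nhdsWithin_of_eventually_nhds
        (Iic_mem_nhds (sub_pos.2 h))] with δ hδ _ using hδ
    · exact Eventually.of_forall fun δ h' => absurd h' h
  obtain ⟨δ, ⟨h1, h2⟩, hδ⟩ := ((h1.and h2).and self_mem_nhdsWithin).exists
  have hδ : 0 < δ := hδ
  refine ⟨δ, hδ, fun v hv hvA => hcb.mem_iff.2 ⟨fun i => ?_, fun ℓ => ?_⟩⟩
  · have h3 := abs_apply_le_of_dotProduct_self zero_le_one (by simpa using hv) i
    have h4 := (abs_le.1 h3).1
    have h5 := h1 i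
    simp only [Pi.add_apply, Pi.smul_apply, smul_eq_mul]
    nlinarith
  · rw [dotProduct_add, dotProduct_smul, smul_eq_mul]
    rcases ((hcb.mem_iff.1 hν).2 ℓ).lt_or_eq with h | h
    · have h3 : c ℓ ⬝ᵥ v ≤ 1 * 1 := dotProduct_le_of_dotProduct_self zero_le_one zero_le_one
        (by simpa using (hcb.c_unit ℓ).le) (by simpa using hv)
      have h4 := h2 ℓ h
      nlinarith
    · have h3 := hvA ℓ ⟨hν, h⟩
      rw [dotProduct_comm] at h3
      nlinarith

variable {α : Measure (Fin n → ℝ)} {Amax R : ℝ} {lam : Fin n → ℝ}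

/-- Under a mean arrival vector in the interior of the capacity region, the queue lengths have
finite second moments in steady state. -/
theorem IsSteadyState.integrable_dotProduct_self [IsProbabilityMeasure α]
    {sched : M → Kernel (Fin n → ℝ) (Fin n → ℝ)} (hsched : sw.IsMaxWeight sched)
    {μ : Measure (Fin n → ℝ)} (hμ : sw.IsSteadyState α sched μ)
    (hα : IsArrivalLaw α Amax lam) (hlam : lam ∈ interior sw.capacityRegion) :
    Integrable (fun q => q ⬝ᵥ q) μ := by
  obtain ⟨R, -, hR⟩ := sw.exists_rate_bound
  -- For the trivial cone the distance is the norm itself, every direction is polar, and the ball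
  -- around the interior point `lam` supplies the drift.
  obtain ⟨W, p, hK⟩ := exists_isConeProjection (n := n) (K := {0}) isClosed_singleton
    (convex_singleton 0) rfl (by simp)
  obtain ⟨δ, hδ, hball⟩ := exists_ball_subset_of_mem_interior hlam
  have := (hμ.sq_dist_cone hsched hα (le_max_right R Amax)
    (fun m x hx i => (hR m x hx i).trans (le_max_left _ _)) hK (by simp) (x₀ := lam) (by simp) hδ
    (fun v hv _ => hball v hv) (by simp; positivity)).1
  refine this.congr (ae_of_all _ fun q => ?_)
  have h0 : p q = 0 := hK.mem q
  simp only [hK.sq_eq, h0, sub_zero]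

/-- State space collapse: the second moment of the distance to the cone generated by the normals of
the facets through `ν` is bounded uniformly over mean arrival vectors close to `ν`. -/
theorem IsFacetDescription.exists_state_space_collapse (hcb : sw.IsFacetDescription c b)
    (hν : ν ∈ sw.capacityRegion) (hpos : ∀ i, 0 < ν i) (Amax : ℝ)
    {W : (Fin n → ℝ) → ℝ} {p : (Fin n → ℝ) → Fin n → ℝ}
    (hK : IsConeProjection (bipolarCone c (sw.activeFacets c b ν)) W p) :
    ∃ ε₀ D : ℝ, 0 < ε₀ ∧ ∀ ε ∈ Set.Ioo 0 ε₀, ∀ (α : Measure (Fin n → ℝ))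
      (sched : M → Kernel (Fin n → ℝ) (Fin n → ℝ)) (μ : Measure (Fin n → ℝ)),
      IsArrivalLaw α Amax ((1 - ε) • ν) → sw.IsMaxWeight sched → sw.IsSteadyState α sched μ →
      Integrable (fun q => W q ^ 2) μ ∧ ∫ q, W q ^ 2 ∂μ ≤ D := by
  obtain ⟨R, -, hR⟩ := sw.exists_rate_bound
  obtain ⟨δ, hδ, hball⟩ := hcb.exists_polar_ball hν hpos
  -- The mean `(1 - ε) • ν` must lie within `δ / 2` of `ν`, where `δ` does not depend on `ε`.
  have hev : ∀ᶠ ε : ℝ in 𝓝[>] 0, ε ^ 2 * (ν ⬝ᵥ ν) < (δ / 2) ^ 2 := by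
    refine eventually_nhdsWithin_of_eventually_nhds ?_
    have : ContinuousAt (fun ε : ℝ => ε ^ 2 * (ν ⬝ᵥ ν)) 0 := by fun_prop
    exact this.eventually_lt continuousAt_const (by simp; positivity)
  obtain ⟨ε₀, hε₀, hsub⟩ := mem_nhdsGT_iff_exists_Ioo_subset.1 hev
  refine ⟨ε₀, ((3 / 2 * (3 * (n * max R Amax ^ 2)) + 3 * √(n * max R Amax ^ 2) ^ 2) ^ 2 / (2 * δ) +
    √(n * max R Amax ^ 2) ^ 3) / δ, hε₀, fun ε hε α sched μ hα hsched hμ => ?_⟩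
  have := hα.prob
  refine hμ.sq_dist_cone hsched hα (le_max_right R Amax)
    (fun m x hx i => (hR m x hx i).trans (le_max_left _ _)) hK
    (fun k hk => nonneg_of_mem_bipolarCone hcb.c_nonneg hk) (x₀ := ν) ?_ hδ
    (fun v hv h => hball v hv fun ℓ hℓ => h _ (mem_bipolarCone hℓ)) ?_
  · intro k hk x hx
    have := hk (x - ν) fun ℓ hℓ => by
      rw [dotProduct_sub, hℓ.2]
      linarith [(hcb.mem_iff.1 hx).2 ℓ]
    rw [sub_dotProduct, dotProduct_comm x, dotProduct_comm ν] at this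
    linarith
  · have h1 : (1 - ε) • ν - ν = (-ε) • ν := by rw [sub_smul, one_smul, neg_smul]; abel
    have h2 : ε ^ 2 * (ν ⬝ᵥ ν) < (δ / 2) ^ 2 := hsub hε
    rw [h1, smul_dotProduct, dotProduct_smul, smul_eq_mul, smul_eq_mul]
    linarith

end GeneralizedSwitch

/-! ### Pathwise error of the quadratic drift identity. -/

theorem abs_dotProduct_le {n : ℕ} {x y : Fin n → ℝ} {X Y : ℝ} (hX : 0 ≤ X) (hx : ∀ i, |x i| ≤ X)
    (hy : ∀ i, |y i| ≤ Y) : |x ⬝ᵥ y| ≤ n * (X * Y) := by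
  calc |x ⬝ᵥ y| ≤ ∑ i, |x i * y i| := Finset.abs_sum_le_sum_abs _ _
    _ ≤ ∑ _i : Fin n, X * Y := Finset.sum_le_sum fun i _ => by
        rw [abs_mul]; exact mul_le_mul (hx i) (hy i) (abs_nonneg _) hX
    _ = n * (X * Y) := by simp

theorem IsConeProjection.abs_sub_apply_le {n : ℕ} {K : Set (Fin n → ℝ)} {W : (Fin n → ℝ) → ℝ}
    {p : (Fin n → ℝ) → Fin n → ℝ} (hK : IsConeProjection K W p) (q : Fin n → ℝ) (i : Fin n) :
    |(q - p q) i| ≤ W q :=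
  abs_apply_le_of_dotProduct_self (hK.nonneg q) (hK.sq_eq q).ge i

namespace GeneralizedSwitch

variable {n : ℕ} {M : Type*} [Fintype M] {sw : GeneralizedSwitch n M} {L : ℕ}
  {c : Fin L → Fin n → ℝ} {A : Set (Fin L)} {T : Finset (Fin L)}
  {W : (Fin n → ℝ) → ℝ} {p : (Fin n → ℝ) → Fin n → ℝ} {R κ₀ κ₃ : ℝ}

/-- For MaxWeight schedules, the deviation from an optimal service vector in the direction of the
projected queue lengths is controlled by the distance to the cone. -/
theorem abs_dotProduct_projMatrix_schedule_le (hT : LinearIndependent ℝ (fun ℓ : T => c ℓ))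
    (hspan : Submodule.span ℝ (c '' T) = Submodule.span ℝ (c '' A))
    (hK : IsConeProjection (bipolarCone c A) W p)
    (hκ₀ : ∀ (v : Fin n → ℝ) (t : ℝ), 0 ≤ t → (∀ j, |v j| ≤ t) →
      ∀ i, |(projMatrix c T *ᵥ v) i| ≤ κ₀ * t) (hR : 0 ≤ R)
    {q s y : Fin n → ℝ} (hle : ∀ ℓ ∈ A, c ℓ ⬝ᵥ s ≤ c ℓ ⬝ᵥ y) (hq : q ⬝ᵥ y ≤ q ⬝ᵥ s)
    (hys : ∀ i, |(y - s) i| ≤ R) :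
    |q ⬝ᵥ projMatrix c T *ᵥ (y - s)| ≤ n * R * (1 + κ₀) * W q := by
  set v := y - s with hv
  set r := q - p q with hr
  have e : q = p q + r := by rw [hr]; abel
  have h1 : p q ⬝ᵥ projMatrix c T *ᵥ v = p q ⬝ᵥ v := by
    rw [dotProduct_projMatrix_mulVec_comm, projMatrix_mulVec_of_mem_bipolarCone hT hspan (hK.mem q),
      dotProduct_comm]
  -- The number `p q ⬝ᵥ v` is squeezed: it is nonnegative because `y` is at least as good as `s` for
  -- all normals, and at most `-(r ⬝ᵥ v)` because `s` is at least as good as `y` for `q`.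
  have h2 : 0 ≤ p q ⬝ᵥ v := by
    have := hK.mem q (-v) fun ℓ hℓ => by
      rw [dotProduct_neg, hv, dotProduct_sub]; linarith [hle ℓ hℓ]
    rw [neg_dotProduct, dotProduct_comm] at this
    linarith
  have h3 : p q ⬝ᵥ v ≤ -(r ⬝ᵥ v) := by
    have h4 : q ⬝ᵥ v ≤ 0 := by rw [hv, dotProduct_sub]; linarith
    rw [hr, sub_dotProduct]
    linarith
  have h5 : |r ⬝ᵥ v| ≤ n * (W q * R) :=
    abs_dotProduct_le (hK.nonneg q) (hK.abs_sub_apply_le q) hys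
  have h6 : |r ⬝ᵥ projMatrix c T *ᵥ v| ≤ n * (W q * (κ₀ * R)) :=
    abs_dotProduct_le (hK.nonneg q) (hK.abs_sub_apply_le q) (hκ₀ v R hR hys)
  have h7 : q ⬝ᵥ projMatrix c T *ᵥ v = p q ⬝ᵥ v + r ⬝ᵥ projMatrix c T *ᵥ v := by
    conv_lhs => rw [e, add_dotProduct, h1]
  rw [h7]
  have h8 : |p q ⬝ᵥ v| ≤ n * (W q * R) := by
    rw [abs_of_nonneg h2]
    exact h3.trans ((neg_le_abs _).trans h5)
  calc _ ≤ |p q ⬝ᵥ v| + |r ⬝ᵥ projMatrix c T *ᵥ v| := abs_add_le _ _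
    _ ≤ n * (W q * R) + n * (W q * (κ₀ * R)) := add_le_add h8 h6
    _ = _ := by ring

/-- As `x i * u i = 0` and `H` fixes `p x`, the product `(Hx) i * u i` equals `(Hr - r) i * u i`
with `r = x - p x`, hence is of order `W x * u i`. Young's inequality splits it with weight `η`, and
`u i ^ 2 ≤ R * u i` makes the second part linear in the loss `U`. -/
theorem abs_dotProduct_projMatrix_unused_le (hT : LinearIndependent ℝ (fun ℓ : T => c ℓ))
    (hspan : Submodule.span ℝ (c '' T) = Submodule.span ℝ (c '' A))
    (hK : IsConeProjection (bipolarCone c A) W p) (hκ₀0 : 0 ≤ κ₀)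
    (hκ₀ : ∀ (v : Fin n → ℝ) (t : ℝ), 0 ≤ t → (∀ j, |v j| ≤ t) →
      ∀ i, |(projMatrix c T *ᵥ v) i| ≤ κ₀ * t) {x u : Fin n → ℝ} (hu : ∀ i, 0 ≤ u i)
    (huR : ∀ i, u i ≤ R) (hxu : ∀ i, x i * u i = 0) (hκ₃0 : 0 ≤ κ₃) {U : ℝ} (hU : 0 ≤ U)
    (hκ₃ : ∀ i, (∃ ℓ ∈ T, c ℓ i ≠ 0) → u i ≤ κ₃ * U) {η : ℝ} (hη : 0 < η) (hR : 0 ≤ R) :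
    |x ⬝ᵥ projMatrix c T *ᵥ u| ≤ n * ((1 + κ₀) * (η * W x ^ 2 + R * κ₃ * U / η)) := by
  have hbound : ∀ i, |(projMatrix c T *ᵥ x) i * u i| ≤
      (1 + κ₀) * (η * W x ^ 2 + R * κ₃ * U / η) := by
    intro i
    by_cases hi : ∃ ℓ ∈ T, c ℓ i ≠ 0
    · set r := x - p x with hr
      have h1 : projMatrix c T *ᵥ x = x - r + projMatrix c T *ᵥ r := by
        conv_lhs => rw [show x = p x + r by rw [hr]; abel]
        rw [Matrix.mulVec_add, projMatrix_mulVec_of_mem_bipolarCone hT hspan (hK.mem x)]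
        congr 1
        rw [hr]; abel
      have h2 : (projMatrix c T *ᵥ x) i * u i = ((projMatrix c T *ᵥ r) i - r i) * u i := by
        have := hxu i
        rw [h1, Pi.add_apply, Pi.sub_apply]
        linarith
      have h3 : |(projMatrix c T *ᵥ r) i - r i| ≤ (1 + κ₀) * W x := by
        have h4 := hκ₀ r _ (hK.nonneg x) (hK.abs_sub_apply_le x) i
        have h5 : |r i| ≤ W x := hK.abs_sub_apply_le x i
        calc _ ≤ |(projMatrix c T *ᵥ r) i| + |r i| := abs_sub _ _
          _ ≤ _ := by linarith
      have h6 : u i ^ 2 ≤ R * κ₃ * U := by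
        have := hκ₃ i hi
        calc u i ^ 2 = u i * u i := sq _
          _ ≤ R * (κ₃ * U) := mul_le_mul (huR i) this (hu i) hR
          _ = _ := by ring
      have h7 : W x * u i ≤ η * W x ^ 2 + u i ^ 2 / η := by
        have : η * W x ^ 2 + u i ^ 2 / η - W x * u i =
            ((2 * η * W x - u i) ^ 2 + 3 * u i ^ 2) / (4 * η) := by
          field_simp; ring
        have : 0 ≤ ((2 * η * W x - u i) ^ 2 + 3 * u i ^ 2) / (4 * η) := by positivity
        linarith
      have h8 : u i ^ 2 / η ≤ R * κ₃ * U / η := div_le_div_of_nonneg_right h6 hη.le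
      rw [h2, abs_mul, abs_of_nonneg (hu i)]
      calc _ ≤ (1 + κ₀) * W x * u i := mul_le_mul_of_nonneg_right h3 (hu i)
        _ = (1 + κ₀) * (W x * u i) := by ring
        _ ≤ _ := mul_le_mul_of_nonneg_left (by linarith) (by linarith)
    -- A coordinate that appears in no normal is annihilated by `H`, so unused service there, which
    -- `U` does not control, contributes nothing.
    · push Not at hi
      have h1 : projMatrix c T *ᵥ Pi.single i 1 = 0 :=
        projMatrix_mulVec_eq_zero fun ℓ hℓ => by simp [hi ℓ hℓ]
      have h2 : (projMatrix c T *ᵥ x) i = 0 := by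
        rw [← single_one_dotProduct i (projMatrix c T *ᵥ x), dotProduct_projMatrix_mulVec_comm, h1,
          dotProduct_zero]
      rw [h2, zero_mul, abs_zero]
      positivity
  rw [dotProduct_projMatrix_mulVec_comm, dotProduct_comm]
  calc _ ≤ ∑ i, |(projMatrix c T *ᵥ x) i * u i| := Finset.abs_sum_le_sum_abs _ _
    _ ≤ ∑ _i : Fin n, (1 + κ₀) * (η * W x ^ 2 + R * κ₃ * U / η) :=
        Finset.sum_le_sum fun i _ => hbound i
    _ = _ := by simp

/-- The total loss of `c ℓ`-weighted service, `ℓ ∈ T`, through suboptimal schedules. -/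
noncomputable def deficit (sw : GeneralizedSwitch n M) (c : Fin L → Fin n → ℝ)
    (T : Finset (Fin L)) (m : M) (s : Fin n → ℝ) : ℝ :=
  ∑ ℓ ∈ T, (sw.maxRate (c ℓ) m - c ℓ ⬝ᵥ s)

/-- There are finitely many channel states and schedules. The gap turns a constant, on slots with a
suboptimal schedule, into a multiple of the deficit. -/
theorem exists_deficit_gap (sw : GeneralizedSwitch n M) (c : Fin L → Fin n → ℝ)
    (T : Finset (Fin L)) :
    ∃ γ : ℝ, 0 < γ ∧ ∀ m, ∀ s ∈ sw.S m, 0 < sw.deficit c T m s → γ ≤ sw.deficit c T m s := by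
  have h : ∀ᶠ γ : ℝ in 𝓝[>] 0, ∀ m, ∀ s ∈ sw.S m, 0 < sw.deficit c T m s →
      γ ≤ sw.deficit c T m s := by
    refine eventually_all.2 fun m => (Finset.eventually_all _).2 fun s _ => ?_
    by_cases h : 0 < sw.deficit c T m s
    · filter_upwards [eventually_nhdsWithin_of_eventually_nhds (Iic_mem_nhds h)] with γ hγ _ using hγ
    · exact Eventually.of_forall fun γ h' => absurd h' h
  obtain ⟨γ, h, hγ⟩ := (h.and self_mem_nhdsWithin).exists
  exact ⟨γ, hγ, h⟩

/-- The constant is the inverse of a positive lower bound for the nonzero entries of the normals;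
nonnegativity rules out cancellation in the sum. -/
theorem exists_apply_le_sum_dotProduct (hc : ∀ ℓ i, 0 ≤ c ℓ i) (T : Finset (Fin L)) :
    ∃ κ₃ : ℝ, 0 ≤ κ₃ ∧ ∀ u : Fin n → ℝ, (∀ i, 0 ≤ u i) → ∀ i, (∃ ℓ ∈ T, c ℓ i ≠ 0) →
      u i ≤ κ₃ * ∑ ℓ ∈ T, c ℓ ⬝ᵥ u := by
  have h : ∀ᶠ θ : ℝ in 𝓝[>] 0, ∀ ℓ i, 0 < c ℓ i → θ ≤ c ℓ i := by
    refine eventually_all.2 fun ℓ => eventually_all.2 fun i => ?_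
    by_cases h : 0 < c ℓ i
    · filter_upwards [eventually_nhdsWithin_of_eventually_nhds (Iic_mem_nhds h)] with γ hγ _ using hγ
    · exact Eventually.of_forall fun γ h' => absurd h' h
  obtain ⟨θ, h, hθ⟩ := (h.and self_mem_nhdsWithin).exists
  have hθ : 0 < θ := hθ
  refine ⟨θ⁻¹, by positivity, fun u hu i ⟨ℓ, hℓ, hi⟩ => ?_⟩
  rw [← div_eq_inv_mul, le_div_iff₀ hθ]
  calc u i * θ ≤ u i * c ℓ i :=
        mul_le_mul_of_nonneg_left (h ℓ i (lt_of_le_of_ne (hc ℓ i) hi.symm)) (hu i)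
    _ = c ℓ i * u i := mul_comm _ _
    _ ≤ c ℓ ⬝ᵥ u := Finset.single_le_sum (f := fun i => c ℓ i * u i)
        (fun i _ => mul_nonneg (hc ℓ i) (hu i)) (Finset.mem_univ i)
    _ ≤ _ := Finset.single_le_sum (f := fun ℓ => c ℓ ⬝ᵥ u)
        (fun ℓ _ => Finset.sum_nonneg fun i _ => mul_nonneg (hc ℓ i) (hu i)) hℓ

/-- Pathwise bound of the error in the quadratic drift identity for the projected queue lengths. -/
theorem exists_drift_error_bound (hc : ∀ ℓ i, 0 ≤ c ℓ i)
    (hT : LinearIndependent ℝ (fun ℓ : T => c ℓ)) (hTA : (T : Set (Fin L)) ⊆ A)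
    (hspan : Submodule.span ℝ (c '' T) = Submodule.span ℝ (c '' A))
    (hK : IsConeProjection (bipolarCone c A) W p) (hR0 : 0 ≤ R)
    (hR : ∀ m, ∀ x ∈ sw.S m, ∀ i, x i ≤ R) {y : M → Fin n → ℝ}
    (hy : ∀ m, y m ∈ convexHull ℝ (sw.S m : Set (Fin n → ℝ)))
    (hyA : ∀ m, 0 < sw.ψ m → ∀ ℓ ∈ A, c ℓ ⬝ᵥ y m = sw.maxRate (c ℓ) m) :
    ∃ κ : ℝ, 0 ≤ κ ∧ ∀ η : ℝ, 0 < η → ∀ (m : M) (q s a : Fin n → ℝ), 0 < sw.ψ m →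
      (∀ i, 0 ≤ q i) → s ∈ sw.maxWeightSchedules m q → (∀ i, 0 ≤ a i) → (∀ i, a i ≤ R) →
      |nextQueue q s a ⬝ᵥ projMatrix c T *ᵥ nextQueue q s a - q ⬝ᵥ projMatrix c T *ᵥ q
        - (2 * (q ⬝ᵥ projMatrix c T *ᵥ a) - 2 * (q ⬝ᵥ projMatrix c T *ᵥ y m)
          + a ⬝ᵥ projMatrix c T *ᵥ a - 2 * (a ⬝ᵥ projMatrix c T *ᵥ y m)
          + y m ⬝ᵥ projMatrix c T *ᵥ y m)|
      ≤ κ * (η * (W q ^ 2 + W (nextQueue q s a) ^ 2) +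
        (1 + 1 / η) * ∑ ℓ ∈ T, (c ℓ ⬝ᵥ nextQueue q s a - c ℓ ⬝ᵥ q - c ℓ ⬝ᵥ a +
          sw.maxRate (c ℓ) m)) := by
  obtain ⟨κ₀, hκ₀0, hκ₀⟩ := exists_abs_mulVec_le (projMatrix c T)
  obtain ⟨κ₁, hκ₁0, hκ₁⟩ := exists_abs_projMatrix_mulVec_le c T
  obtain ⟨κ₃, hκ₃0, hκ₃⟩ := exists_apply_le_sum_dotProduct hc T
  obtain ⟨γ, hγ, hgap⟩ := sw.exists_deficit_gap c T
  set k₁ := n * R * (1 + κ₀) with hk₁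
  set k₂ := n * (R * κ₁) with hk₂
  set k₃ := n * (1 + κ₀) with hk₃
  have hk₁0 : 0 ≤ k₁ := by positivity
  have hk₂0 : 0 ≤ k₂ := by positivity
  have hk₃0 : 0 ≤ k₃ := by positivity
  have hγi : 0 ≤ γ⁻¹ := by positivity
  refine ⟨2 * k₁ * (1 + γ⁻¹) + 4 * k₂ + 2 * k₃ * (1 + R * κ₃), by positivity,
    fun η hη m q s a hm hq hs ha haR => ?_⟩
  set H := projMatrix c T with hH
  set u := unusedService q s a with hu
  set x := nextQueue q s a with hx
  have hs0 := sw.S_nonneg _ _ hs.1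
  have hsR := hR _ _ hs.1
  have hy0 := nonneg_of_mem_convexHull (hy m)
  have hyR := le_of_mem_convexHull (hR m) (hy m)
  have hu0 : ∀ i, 0 ≤ u i := fun i => unusedService_nonneg _ _ _ i
  have huR : ∀ i, u i ≤ R := fun i => unusedService_le (hq i) (ha i) (hs0 i) (hsR i)
  have hys : ∀ i, |(y m - s) i| ≤ R := fun i => by
    rw [Pi.sub_apply, abs_le]
    constructor <;> linarith [hs0 i, hsR i, hy0 i, hyR i]
  have hay : ∀ i, |(a - y m) i| ≤ R := fun i => by
    rw [Pi.sub_apply, abs_le]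
    constructor <;> linarith [ha i, haR i, hy0 i, hyR i]
  set d := sw.deficit c T m s with hd
  set U := ∑ ℓ ∈ T, c ℓ ⬝ᵥ u with hU
  set Z := ∑ ℓ ∈ T, (c ℓ ⬝ᵥ x - c ℓ ⬝ᵥ q - c ℓ ⬝ᵥ a + sw.maxRate (c ℓ) m) with hZ
  have hcu : ∀ ℓ, 0 ≤ c ℓ ⬝ᵥ u := fun ℓ =>
    Finset.sum_nonneg fun i _ => mul_nonneg (hc ℓ i) (hu0 i)
  have hds : ∀ ℓ, 0 ≤ sw.maxRate (c ℓ) m - c ℓ ⬝ᵥ s := fun ℓ =>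
    sub_nonneg.2 (dotProduct_le_maxRate _ hs.1)
  have hU0 : 0 ≤ U := Finset.sum_nonneg fun ℓ _ => hcu ℓ
  have hd0 : 0 ≤ d := Finset.sum_nonneg fun ℓ _ => hds ℓ
  -- The loss in the statement is written through queue lengths and arrivals so that its mean
  -- follows from stationarity; here it splits into unused service and schedule deficit.
  have hZe : Z = U + d := by
    rw [hZ, hU, hd, deficit, ← Finset.sum_add_distrib]
    refine Finset.sum_congr rfl fun ℓ _ => ?_
    have : x = q + a - s + u := rfl
    rw [this, dotProduct_add, dotProduct_sub, dotProduct_add]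
    ring
  have hdsum : ∑ ℓ ∈ T, |c ℓ ⬝ᵥ (y m - s)| = d := by
    rw [hd, deficit]
    refine Finset.sum_congr rfl fun ℓ hℓ => ?_
    rw [dotProduct_sub, hyA m hm ℓ (hTA hℓ), abs_of_nonneg (hds ℓ)]
  have hUsum : ∑ ℓ ∈ T, |c ℓ ⬝ᵥ u| = U :=
    Finset.sum_congr rfl fun ℓ _ => abs_of_nonneg (hcu ℓ)
  have hHys : ∀ i, |(H *ᵥ (y m - s)) i| ≤ κ₁ * d := fun i => hdsum ▸ hκ₁ _ i
  have hHu : ∀ i, |(H *ᵥ u) i| ≤ κ₁ * U := fun i => hUsum ▸ hκ₁ _ i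
  -- With zero deficit, `H *ᵥ (y m - s)` vanishes. Otherwise `d ≥ γ`, and Young's inequality bounds
  -- `W q` by `η * W q ^ 2 + 1 / η`, whose constant is paid for by `γ⁻¹ * d`.
  have b1 : |q ⬝ᵥ H *ᵥ (y m - s)| ≤ k₁ * (1 + γ⁻¹) * (η * W q ^ 2 + 1 / η * d) := by
    rcases hd0.eq_or_lt with h0 | h0
    · have h1 : H *ᵥ (y m - s) = 0 := by
        ext i
        have := hHys i
        rw [← h0, mul_zero] at this
        exact abs_nonpos_iff.1 this
      rw [h1, dotProduct_zero, abs_zero]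
      positivity
    · have h1 := hgap m s hs.1 h0
      have h2 := abs_dotProduct_projMatrix_schedule_le hT hspan hK hκ₀ hR0 (q := q) (s := s)
        (y := y m) (fun ℓ hℓ => by linarith [hyA m hm ℓ hℓ, hds ℓ])
        (dotProduct_le_of_mem_convexHull (hy m) hs.2) hys
      have h3 : W q ≤ η * W q ^ 2 + 1 / η := by
        have : η * W q ^ 2 + 1 / η - W q = ((2 * η * W q - 1) ^ 2 + 3) / (4 * η) := by
          field_simp; ring
        have : 0 ≤ ((2 * η * W q - 1) ^ 2 + 3) / (4 * η) := by positivity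
        linarith
      have h4 : 1 / η ≤ γ⁻¹ * (1 / η * d) := by
        have : 1 ≤ γ⁻¹ * d := by
          rw [← div_eq_inv_mul, le_div_iff₀ hγ]; linarith
        calc 1 / η = 1 / η * 1 := (mul_one _).symm
          _ ≤ 1 / η * (γ⁻¹ * d) := mul_le_mul_of_nonneg_left this (by positivity)
          _ = _ := by ring
      have h5 : 0 ≤ γ⁻¹ * (η * W q ^ 2) := by positivity
      have h6 : 0 ≤ 1 / η * d := by positivity
      calc _ ≤ k₁ * W q := h2
        _ ≤ k₁ * ((1 + γ⁻¹) * (η * W q ^ 2 + 1 / η * d)) :=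
          mul_le_mul_of_nonneg_left (by linarith) hk₁0
        _ = _ := by ring
  have b2 : |(a - y m) ⬝ᵥ H *ᵥ (y m - s)| ≤ k₂ * d :=
    (abs_dotProduct_le hR0 hay hHys).trans_eq (by rw [hk₂]; ring)
  have b3 : |(y m - s) ⬝ᵥ H *ᵥ (y m - s)| ≤ k₂ * d :=
    (abs_dotProduct_le hR0 hys hHys).trans_eq (by rw [hk₂]; ring)
  have b4 : |u ⬝ᵥ H *ᵥ u| ≤ k₂ * U :=
    (abs_dotProduct_le hR0 (fun i => by rw [abs_of_nonneg (hu0 i)]; exact huR i) hHu).trans_eq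
      (by rw [hk₂]; ring)
  have b5 : |x ⬝ᵥ H *ᵥ u| ≤ k₃ * (1 + R * κ₃) * (η * W x ^ 2 + 1 / η * U) := by
    refine (abs_dotProduct_projMatrix_unused_le hT hspan hK hκ₀0 hκ₀ hu0 huR
      (fun i => nextQueue_mul_unusedService q s a i) hκ₃0 hU0 (hκ₃ u hu0) hη hR0).trans ?_
    have h5 : 0 ≤ R * κ₃ * (η * W x ^ 2) := by positivity
    have h6 : 0 ≤ 1 / η * U := by positivity
    calc _ = k₃ * (η * W x ^ 2 + R * κ₃ * (1 / η * U)) := by rw [hk₃]; ring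
      _ ≤ k₃ * ((1 + R * κ₃) * (η * W x ^ 2 + 1 / η * U)) :=
        mul_le_mul_of_nonneg_left (by linarith) hk₃0
      _ = _ := by ring
  -- The schedule is compared with `y m`, and unused service is paired with `x` rather than `q` so
  -- that complementarity applies; this is why `u ⬝ᵥ H *ᵥ u` enters with a minus sign.
  have hid : x ⬝ᵥ H *ᵥ x - q ⬝ᵥ H *ᵥ q - (2 * (q ⬝ᵥ H *ᵥ a) - 2 * (q ⬝ᵥ H *ᵥ y m)
      + a ⬝ᵥ H *ᵥ a - 2 * (a ⬝ᵥ H *ᵥ y m) + y m ⬝ᵥ H *ᵥ y m) =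
      2 * (q ⬝ᵥ H *ᵥ (y m - s)) + 2 * ((a - y m) ⬝ᵥ H *ᵥ (y m - s)) +
        (y m - s) ⬝ᵥ H *ᵥ (y m - s) - u ⬝ᵥ H *ᵥ u + 2 * (x ⬝ᵥ H *ᵥ u) := by
    have : x = q + a - s + u := rfl
    rw [this]
    simp only [Matrix.mulVec_add, Matrix.mulVec_sub, dotProduct_add, dotProduct_sub,
      add_dotProduct, sub_dotProduct]
    rw [hH, dotProduct_projMatrix_mulVec_comm a q, dotProduct_projMatrix_mulVec_comm s q,
      dotProduct_projMatrix_mulVec_comm u q, dotProduct_projMatrix_mulVec_comm s a,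
      dotProduct_projMatrix_mulVec_comm u a, dotProduct_projMatrix_mulVec_comm u s,
      dotProduct_projMatrix_mulVec_comm (y m) s]
    ring
  rw [hid, hZe]
  set K₁ := k₁ * (1 + γ⁻¹)
  set K₃ := k₃ * (1 + R * κ₃)
  have hK₁ : 0 ≤ K₁ := by positivity
  have hK₃ : 0 ≤ K₃ := by positivity
  have habs : |2 * (q ⬝ᵥ H *ᵥ (y m - s)) + 2 * ((a - y m) ⬝ᵥ H *ᵥ (y m - s)) +
        (y m - s) ⬝ᵥ H *ᵥ (y m - s) - u ⬝ᵥ H *ᵥ u + 2 * (x ⬝ᵥ H *ᵥ u)| ≤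
      2 * (K₁ * (η * W q ^ 2 + 1 / η * d)) + 3 * (k₂ * d) + k₂ * U +
        2 * (K₃ * (η * W x ^ 2 + 1 / η * U)) := by
    rw [abs_le] at b1 b2 b3 b4 b5 ⊢
    constructor <;> linarith [b1.1, b1.2, b2.1, b2.2, b3.1, b3.2, b4.1, b4.2, b5.1, b5.2]
  refine habs.trans ?_
  have g1 : 0 ≤ η * W q ^ 2 := by positivity
  have g2 : 0 ≤ η * W x ^ 2 := by positivity
  have g3 : 0 ≤ 1 / η * d := by positivity
  have g4 : 0 ≤ 1 / η * U := by positivity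
  have j1 : K₁ * (η * W q ^ 2 + 1 / η * d) ≤
      K₁ * (η * (W q ^ 2 + W x ^ 2) + (1 + 1 / η) * (U + d)) :=
    mul_le_mul_of_nonneg_left (by linarith) hK₁
  have j2 : k₂ * (3 * d + U) ≤ k₂ * (4 * (η * (W q ^ 2 + W x ^ 2) + (1 + 1 / η) * (U + d))) :=
    mul_le_mul_of_nonneg_left (by linarith) hk₂0
  have j3 : K₃ * (η * W x ^ 2 + 1 / η * U) ≤
      K₃ * (η * (W q ^ 2 + W x ^ 2) + (1 + 1 / η) * (U + d)) :=
    mul_le_mul_of_nonneg_left (by linarith) hK₃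
  calc _ = 2 * (K₁ * (η * W q ^ 2 + 1 / η * d)) + k₂ * (3 * d + U) +
        2 * (K₃ * (η * W x ^ 2 + 1 / η * U)) := by ring
    _ ≤ 2 * (K₁ * (η * (W q ^ 2 + W x ^ 2) + (1 + 1 / η) * (U + d))) +
        k₂ * (4 * (η * (W q ^ 2 + W x ^ 2) + (1 + 1 / η) * (U + d))) +
        2 * (K₃ * (η * (W q ^ 2 + W x ^ 2) + (1 + 1 / η) * (U + d))) := by linarith
    _ = _ := by ring

end GeneralizedSwitch

/-! ### The stationary mean identity. -/

namespace HasMean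

variable {Ω : Type*} [MeasurableSpace Ω] {P : Measure Ω} {f g : Ω → ℝ} {c d : ℝ}

theorem mul_of_indepFun (hf : HasMean P f c) (hg : HasMean P g d) (h : IndepFun f g P) :
    HasMean P (fun ω => f ω * g ω) (c * d) :=
  ⟨h.integrable_mul hf.1 hg.1, by
    rw [h.integral_fun_mul_eq_mul_integral hf.1.aestronglyMeasurable hg.1.aestronglyMeasurable,
      hf.2, hg.2]⟩

theorem dotProduct_mulVec {ι : Type*} [Fintype ι] (A : Matrix ι ι ℝ) {x y : Ω → ι → ℝ}
    {e : ι → ι → ℝ} (h : ∀ i j, HasMean P (fun ω => x ω i * y ω j) (e i j)) :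
    HasMean P (fun ω => x ω ⬝ᵥ A *ᵥ y ω) (∑ i, ∑ j, A i j * e i j) := by
  simp only [dotProduct_mulVec_eq_sum]
  exact HasMean.sum fun i _ => HasMean.sum fun j _ => (h i j).const_mul _

theorem dotProduct {ι : Type*} [Fintype ι] (w : ι → ℝ) {x : Ω → ι → ℝ}
    {e : ι → ℝ} (h : ∀ i, HasMean P (fun ω => x ω i) (e i)) :
    HasMean P (fun ω => w ⬝ᵥ x ω) (w ⬝ᵥ e) :=
  HasMean.sum fun i _ => (h i).const_mul _

end HasMean

theorem integrable_apply_of_dotProduct_self {n : ℕ} {μ : Measure (Fin n → ℝ)} [IsFiniteMeasure μ]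
    (hμ : Integrable (fun q => q ⬝ᵥ q) μ) (i : Fin n) : Integrable (fun q => q i) μ := by
  refine ((integrable_const (1 : ℝ)).add hμ).mono'
    (measurable_pi_apply i).aestronglyMeasurable (ae_of_all _ fun q => ?_)
  have h1 : q i * q i ≤ q ⬝ᵥ q := Finset.single_le_sum (f := fun i => q i * q i)
    (fun i _ => mul_self_nonneg _) (Finset.mem_univ i)
  rw [Real.norm_eq_abs, abs_le]
  simp only [Pi.add_apply]
  constructor <;> nlinarith [sq_nonneg (q i - 1), sq_nonneg (q i + 1)]

theorem IsArrivalLaw.integral_mul {n : ℕ} {α : Measure (Fin n → ℝ)} {Amax : ℝ} {lam : Fin n → ℝ}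
    (hα : IsArrivalLaw α Amax lam) (i j : Fin n) :
    HasMean α (fun a => a i * a j) (covMat α i j + lam i * lam j) := by
  have := hα.prob
  have hmem : ∀ i, MemLp (fun a : Fin n → ℝ => a i) 2 α := fun i => by
    refine MemLp.of_bound (measurable_pi_apply i).aestronglyMeasurable Amax ?_
    filter_upwards [hα.bounded] with a ha
    rw [Real.norm_of_nonneg (ha i).1]
    exact (ha i).2
  refine ⟨(hmem i).integrable_mul (hmem j), ?_⟩
  rw [covMat, Matrix.of_apply, covariance_eq_sub (hmem i) (hmem j), hα.mean, hα.mean,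
    sub_add_cancel]
  rfl

namespace GeneralizedSwitch

variable {n : ℕ} {M : Type*} [Fintype M] {sw : GeneralizedSwitch n M} {L : ℕ}
  {c : Fin L → Fin n → ℝ} {b : Fin L → ℝ} {ν : Fin n → ℝ} {T : Finset (Fin L)}
  {W : (Fin n → ℝ) → ℝ}

/-- The second moment of the projection of optimal service vectors. -/
theorem sum_dotProduct_projMatrix {y : M → Fin n → ℝ}
    (hyT : ∀ m, 0 < sw.ψ m → ∀ ℓ ∈ T, c ℓ ⬝ᵥ y m = sw.maxRate (c ℓ) m)
    (hν : ∀ ℓ ∈ T, c ℓ ⬝ᵥ ν = ∑ m, sw.ψ m * sw.maxRate (c ℓ) m) :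
    ∑ m, sw.ψ m * (y m ⬝ᵥ projMatrix c T *ᵥ y m) =
      hadamardSum ((colMatrix c T)ᵀ * colMatrix c T)⁻¹ ((sw.covB c).submatrix (↑) (↑)) +
        ν ⬝ᵥ projMatrix c T *ᵥ ν := by
  set N := ((colMatrix c T)ᵀ * colMatrix c T)⁻¹ with hN
  have h1 : ∀ m, sw.ψ m * (y m ⬝ᵥ projMatrix c T *ᵥ y m) =
      ∑ k : T, ∑ ℓ : T, N k ℓ * (sw.ψ m * (sw.maxRate (c k) m * sw.maxRate (c ℓ) m)) := by
    intro m
    -- States of probability zero are split off, since `y m` is known to be optimal only when `ψ m >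
    -- 0`.
    rcases (sw.ψ_mem.1 m).eq_or_lt with h | h
    · simp [← h]
    · rw [dotProduct_projMatrix_mulVec, dotProduct_mulVec_eq_sum, Finset.mul_sum]
      refine Finset.sum_congr rfl fun k _ => ?_
      rw [Finset.mul_sum]
      refine Finset.sum_congr rfl fun ℓ _ => ?_
      rw [transpose_colMatrix_mulVec, transpose_colMatrix_mulVec, hyT m h k k.2, hyT m h ℓ ℓ.2]
      ring
  have h2 : ν ⬝ᵥ projMatrix c T *ᵥ ν = ∑ k : T, ∑ ℓ : T, N k ℓ *
      ((∑ m, sw.ψ m * sw.maxRate (c k) m) * ∑ m, sw.ψ m * sw.maxRate (c ℓ) m) := by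
    rw [dotProduct_projMatrix_mulVec, dotProduct_mulVec_eq_sum]
    refine Finset.sum_congr rfl fun k _ => Finset.sum_congr rfl fun ℓ _ => ?_
    rw [transpose_colMatrix_mulVec, transpose_colMatrix_mulVec, hν k k.2, hν ℓ ℓ.2]
  rw [Finset.sum_congr rfl fun m _ => h1 m, Finset.sum_comm, h2, hadamardSum_eq,
    ← Finset.sum_add_distrib]
  refine Finset.sum_congr rfl fun k _ => ?_
  rw [Finset.sum_comm, ← Finset.sum_add_distrib]
  refine Finset.sum_congr rfl fun ℓ _ => ?_
  rw [← Finset.mul_sum, ← mul_add, Matrix.submatrix_apply, covB, Matrix.of_apply, sub_add_cancel]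

/-- Stationarity of the squared norm of the projected queue lengths determines their mean in the
direction of `ν` up to the expected pathwise error. -/
theorem IsSteadyState.abs_mean_projMatrix_sub_le {α : Measure (Fin n → ℝ)} {Amax R ε κ D η : ℝ}
    {sched : M → Kernel (Fin n → ℝ) (Fin n → ℝ)} (hsched : sw.IsMaxWeight sched)
    {μ : Measure (Fin n → ℝ)} (hμ : sw.IsSteadyState α sched μ)
    (hα : IsArrivalLaw α Amax ((1 - ε) • ν)) (hAR : Amax ≤ R)
    (hμ2 : Integrable (fun q => q ⬝ᵥ q) μ) (hW : Integrable (fun q => W q ^ 2) μ)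
    (hD : ∫ q, W q ^ 2 ∂μ ≤ D) {y : M → Fin n → ℝ} (hyν : ν = ∑ m, sw.ψ m • y m)
    (hyT : ∀ m, 0 < sw.ψ m → ∀ ℓ ∈ T, c ℓ ⬝ᵥ y m = sw.maxRate (c ℓ) m)
    (hbν : ∀ ℓ ∈ T, c ℓ ⬝ᵥ ν = b ℓ)
    (hν : ∀ ℓ ∈ T, c ℓ ⬝ᵥ ν = ∑ m, sw.ψ m * sw.maxRate (c ℓ) m) (hκ0 : 0 ≤ κ) (hη : 0 < η)
    (hκ : ∀ (m : M) (q s a : Fin n → ℝ), 0 < sw.ψ m →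
      (∀ i, 0 ≤ q i) → s ∈ sw.maxWeightSchedules m q → (∀ i, 0 ≤ a i) → (∀ i, a i ≤ R) →
      |nextQueue q s a ⬝ᵥ projMatrix c T *ᵥ nextQueue q s a - q ⬝ᵥ projMatrix c T *ᵥ q
        - (2 * (q ⬝ᵥ projMatrix c T *ᵥ a) - 2 * (q ⬝ᵥ projMatrix c T *ᵥ y m)
          + a ⬝ᵥ projMatrix c T *ᵥ a - 2 * (a ⬝ᵥ projMatrix c T *ᵥ y m)
          + y m ⬝ᵥ projMatrix c T *ᵥ y m)|
      ≤ κ * (η * (W q ^ 2 + W (nextQueue q s a) ^ 2) +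
        (1 + 1 / η) * ∑ ℓ ∈ T, (c ℓ ⬝ᵥ nextQueue q s a - c ℓ ⬝ᵥ q - c ℓ ⬝ᵥ a +
          sw.maxRate (c ℓ) m))) :
    |2 * ε * ((fun i => ∫ q, q i ∂μ) ⬝ᵥ projMatrix c T *ᵥ ν) - hadamardSum (projMatrix c T) (covMat α)
      - hadamardSum ((colMatrix c T)ᵀ * colMatrix c T)⁻¹ ((sw.covB c).submatrix (↑) (↑))
      - ε ^ 2 * (ν ⬝ᵥ projMatrix c T *ᵥ ν)| ≤
    κ * (η * (2 * D) + (1 + 1 / η) * (ε * ∑ ℓ ∈ T, b ℓ)) := by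
  have := hα.prob
  have := hμ.prob
  have hnn := hμ.ae_nonneg hsched
  obtain ⟨Ω, _, P, m, q, s, a, h, hq, hnext⟩ := sw.exists_isStep α hsched μ
  rw [hμ.invariant.def] at hnext
  have := h.prob
  set H := projMatrix c T with hH
  set x : Ω → Fin n → ℝ := fun ω => nextQueue (q ω) (s ω) (a ω) with hx
  have lift : ∀ {ν' : Measure (Fin n → ℝ)} {z : Ω → Fin n → ℝ} (_ : Measurable z)
      (_ : P.map z = ν') {f : (Fin n → ℝ) → ℝ} {e : ℝ} (_ : HasMean ν' f e),
      HasMean P (fun ω => f (z ω)) e := by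
    rintro ν' z hz rfl f e hf
    exact ⟨hf.1.comp_measurable hz, by rw [← hf.2, integral_map hz.aemeasurable hf.1.1]⟩
  have hi1 := integrable_apply_of_dotProduct_self hμ2
  have hi2 : ∀ i j, Integrable (fun q : Fin n → ℝ => q i * q j) μ := fun i j => by
    refine hμ2.mono' (by fun_prop) (ae_of_all _ fun q => ?_)
    have h1 : ∀ i, q i * q i ≤ q ⬝ᵥ q := fun i => Finset.single_le_sum (f := fun i => q i * q i)
      (fun i _ => mul_self_nonneg _) (Finset.mem_univ i)
    have h2 := h1 i
    have h3 := h1 j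
    rw [Real.norm_eq_abs, abs_le]
    constructor <;> nlinarith [sq_nonneg (q i - q j), sq_nonneg (q i + q j)]
  set mq : Fin n → ℝ := fun i => ∫ q, q i ∂μ with hmq
  have mq1 : ∀ i, HasMean P (fun ω => q ω i) (mq i) := fun i =>
    lift h.measurable_q hq (HasMean.of_integrable (hi1 i))
  have mx1 : ∀ i, HasMean P (fun ω => x ω i) (mq i) := fun i =>
    lift h.measurable_next hnext (HasMean.of_integrable (hi1 i))
  have ma1 : ∀ i, HasMean P (fun ω => a ω i) ((1 - ε) * ν i) := fun i =>
    ⟨h.integrable_arrival hα i, h.integral_arrival hα i⟩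
  have mm1 : ∀ g : M → ℝ, HasMean P (fun ω => g (m ω)) (∑ k, sw.ψ k * g k) := fun g =>
    ⟨h.integrable_channel g, h.integral_m g⟩
  have my1 : ∀ i, HasMean P (fun ω => y (m ω) i) (ν i) := fun i => by
    have := mm1 fun k => y k i
    convert this using 1
    rw [hyν, Finset.sum_apply]
    rfl
  have mqq := HasMean.dotProduct_mulVec H (x := q) (y := q) fun i j =>
    lift h.measurable_q hq (HasMean.of_integrable (hi2 i j))
  have mxx := HasMean.dotProduct_mulVec H (x := x) (y := x) fun i j =>
    lift h.measurable_next hnext (HasMean.of_integrable (hi2 i j))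
  have mqa := HasMean.dotProduct_mulVec H (x := q) (y := a) fun i j =>
    (mq1 i).mul_of_indepFun (ma1 j)
      (h.indep_q_a.comp (measurable_pi_apply i) (measurable_pi_apply j))
  have mqy := HasMean.dotProduct_mulVec H (x := q) (y := fun ω => y (m ω)) fun i j =>
    (mq1 i).mul_of_indepFun (my1 j)
      ((h.indep_m_q fun k => y k j).symm.comp (measurable_pi_apply i) measurable_id)
  have may := HasMean.dotProduct_mulVec H (x := a) (y := fun ω => y (m ω)) fun i j =>
    (ma1 i).mul_of_indepFun (my1 j)
      ((h.indep_m_a fun k => y k j).symm.comp (measurable_pi_apply i) measurable_id)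
  have maa := HasMean.dotProduct_mulVec H (x := a) (y := a) fun i j =>
    lift h.measurable_a h.law_a (hα.integral_mul i j)
  have myy := mm1 fun k => y k ⬝ᵥ H *ᵥ y k
  rw [sum_dotProduct_projMatrix hyT hν] at myy
  have e1 : ∑ i, ∑ j, H i j * (mq i * ν j) = mq ⬝ᵥ H *ᵥ ν := (dotProduct_mulVec_eq_sum _ _ _).symm
  have e2 : ∑ i, ∑ j, H i j * (mq i * ((1 - ε) * ν j)) = (1 - ε) * (mq ⬝ᵥ H *ᵥ ν) := by
    rw [← e1, Finset.mul_sum]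
    refine Finset.sum_congr rfl fun i _ => ?_
    rw [Finset.mul_sum]
    exact Finset.sum_congr rfl fun j _ => by ring
  have e3 : ∑ i, ∑ j, H i j * ((1 - ε) * ν i * ν j) = (1 - ε) * (ν ⬝ᵥ H *ᵥ ν) := by
    rw [dotProduct_mulVec_eq_sum, Finset.mul_sum]
    refine Finset.sum_congr rfl fun i _ => ?_
    rw [Finset.mul_sum]
    exact Finset.sum_congr rfl fun j _ => by ring
  have e4 : ∑ i, ∑ j, H i j * (covMat α i j + ((1 - ε) • ν) i * ((1 - ε) • ν) j) =
      hadamardSum H (covMat α) + (1 - ε) ^ 2 * (ν ⬝ᵥ H *ᵥ ν) := by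
    rw [dotProduct_mulVec_eq_sum, hadamardSum_eq, Finset.mul_sum, ← Finset.sum_add_distrib]
    refine Finset.sum_congr rfl fun i _ => ?_
    rw [Finset.mul_sum, ← Finset.sum_add_distrib]
    exact Finset.sum_congr rfl fun j _ => by simp only [Pi.smul_apply, smul_eq_mul]; ring
  rw [e2] at mqa
  rw [e1] at mqy
  rw [e3] at may
  rw [e4] at maa
  -- By invariance the means of the two quadratic forms cancel. The `q` terms leave `-2 * ε` times
  -- the mean in direction `Hν`, and the coefficients of `ν ⬝ᵥ H *ᵥ ν` add up to `(1 - ε) ^ 2 - 2 *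
  -- (1 - ε) + 1 = ε ^ 2`.
  have merr := (mxx.sub mqq).sub
    (((((mqa.const_mul 2).sub (mqy.const_mul 2)).add maa).sub (may.const_mul 2)).add myy)
  have mW := HasMean.of_integrable hW
  -- Stationarity cancels `c ℓ ⬝ᵥ x` against `c ℓ ⬝ᵥ q`; what remains is optimal minus arriving
  -- work, `b ℓ - (1 - ε) * b ℓ`.
  have mZ : HasMean P (fun ω => ∑ ℓ ∈ T, (c ℓ ⬝ᵥ x ω - c ℓ ⬝ᵥ q ω - c ℓ ⬝ᵥ a ω +
      sw.maxRate (c ℓ) (m ω))) (ε * ∑ ℓ ∈ T, b ℓ) := by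
    rw [Finset.mul_sum]
    refine HasMean.sum fun ℓ hℓ => ?_
    have := (((HasMean.dotProduct (c ℓ) mx1).sub (HasMean.dotProduct (c ℓ) mq1)).sub
      (HasMean.dotProduct (c ℓ) ma1)).add (mm1 (sw.maxRate (c ℓ)))
    convert this using 1
    have e5 : (c ℓ ⬝ᵥ fun i => (1 - ε) * ν i) = (1 - ε) * b ℓ := by
      rw [← hbν ℓ hℓ]
      exact dotProduct_smul (1 - ε) (c ℓ) ν
    rw [e5, ← hν ℓ hℓ, hbν ℓ hℓ]
    ring
  have mbound := ((((lift h.measurable_q hq mW).add (lift h.measurable_next hnext mW)).const_mul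
    η).add (mZ.const_mul (1 + 1 / η))).const_mul κ
  have hqnn : ∀ᵐ ω ∂P, ∀ i, 0 ≤ q ω i := by
    rw [← hq] at hnn
    exact ae_of_ae_map h.measurable_q.aemeasurable hnn
  have hpath := ((hqnn.and h.argmax).and (h.pos_m.and (h.ae_arrival hα))).mono fun ω hω =>
    hκ (m ω) (q ω) (s ω) (a ω) hω.2.1 hω.1.1 hω.1.2 (fun i => (hω.2.2 i).1)
      fun i => (hω.2.2 i).2.trans hAR
  have u1 := merr.mono mbound (hpath.mono fun ω hω => (abs_le.1 hω).2)
  have u2 := (mbound.const_mul (-1)).mono merr (hpath.mono fun ω hω => by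
    have := (abs_le.1 hω).1
    linarith)
  have u3 : κ * (η * (∫ q, W q ^ 2 ∂μ + ∫ q, W q ^ 2 ∂μ) + (1 + 1 / η) * (ε * ∑ ℓ ∈ T, b ℓ)) ≤
      κ * (η * (2 * D) + (1 + 1 / η) * (ε * ∑ ℓ ∈ T, b ℓ)) := by
    refine mul_le_mul_of_nonneg_left ?_ hκ0
    have := mul_le_mul_of_nonneg_left hD hη.le
    linarith
  rw [abs_le]
  constructor <;> linarith

end GeneralizedSwitch

/-! ### From the projected mean to all directions `w`, and the heavy traffic limit. -/

namespace GeneralizedSwitch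

variable {n : ℕ} {M : Type*} [Fintype M] {sw : GeneralizedSwitch n M} {L : ℕ}
  {c : Fin L → Fin n → ℝ} {b : Fin L → ℝ} {ν : Fin n → ℝ} {T : Finset (Fin L)}
  {W : (Fin n → ℝ) → ℝ} {p : (Fin n → ℝ) → Fin n → ℝ} {A : Set (Fin L)} {R κ₀ : ℝ}

theorem abs_apply_le_of_mem_capacityRegion (hR : ∀ m, ∀ x ∈ sw.S m, ∀ i, x i ≤ R)
    {x : Fin n → ℝ} (hx : x ∈ sw.capacityRegion) (i : Fin n) : |x i| ≤ R := by
  obtain ⟨y, hy, rfl⟩ := hx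
  rw [Finset.sum_apply]
  have h0 : ∀ m, 0 ≤ (sw.ψ m • y m) i := fun m =>
    mul_nonneg (sw.ψ_mem.1 m) (nonneg_of_mem_convexHull (hy m) i)
  rw [abs_of_nonneg (Finset.sum_nonneg fun m _ => h0 m)]
  calc ∑ m, (sw.ψ m • y m) i ≤ ∑ m, sw.ψ m * R := Finset.sum_le_sum fun m _ =>
        mul_le_mul_of_nonneg_left (le_of_mem_convexHull (hR m) (hy m) i) (sw.ψ_mem.1 m)
    _ = R := by rw [← Finset.sum_mul, sw.ψ_mem.2, one_mul]

/-- A vector that differs from `ν` by a vector orthogonal to the normals sees the queue lengths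
like the projection of `ν`, up to the distance to the cone. -/
theorem abs_dotProduct_sub_projMatrix_le (hT : LinearIndependent ℝ (fun ℓ : T => c ℓ))
    (hspan : Submodule.span ℝ (c '' T) = Submodule.span ℝ (c '' A))
    (hK : IsConeProjection (bipolarCone c A) W p) (hR : 0 ≤ R)
    (hκ₀ : ∀ (v : Fin n → ℝ) (t : ℝ), 0 ≤ t → (∀ j, |v j| ≤ t) →
      ∀ i, |(projMatrix c T *ᵥ v) i| ≤ κ₀ * t) {w : Fin n → ℝ} (hw : ∀ i, |w i| ≤ R)
    (hwν : ∀ ℓ ∈ T, c ℓ ⬝ᵥ w = c ℓ ⬝ᵥ ν) (q : Fin n → ℝ) :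
    |q ⬝ᵥ w - q ⬝ᵥ projMatrix c T *ᵥ ν| ≤ n * R * (1 + κ₀) * W q := by
  have h1 : projMatrix c T *ᵥ w = projMatrix c T *ᵥ ν := by
    rw [← sub_eq_zero, ← Matrix.mulVec_sub]
    exact projMatrix_mulVec_eq_zero fun ℓ hℓ => by rw [dotProduct_sub, hwν ℓ hℓ, sub_self]
  -- `H` is symmetric and fixes `p q`, so only `q - p q` sees the part of `w` outside the span.
  have h2 : p q ⬝ᵥ (w - projMatrix c T *ᵥ w) = 0 := by
    rw [dotProduct_sub, dotProduct_projMatrix_mulVec_comm,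
      projMatrix_mulVec_of_mem_bipolarCone hT hspan (hK.mem q), dotProduct_comm, sub_self]
  have h3 : q ⬝ᵥ w - q ⬝ᵥ projMatrix c T *ᵥ ν = (q - p q) ⬝ᵥ (w - projMatrix c T *ᵥ w) := by
    rw [sub_dotProduct, h2, sub_zero, dotProduct_sub, h1]
  rw [h3]
  refine (abs_dotProduct_le (Y := R + κ₀ * R) (hK.nonneg q) (hK.abs_sub_apply_le q)
    fun i => ?_).trans_eq (by ring)
  exact (abs_sub _ _).trans (add_le_add (hw i) (hκ₀ w R hR hw i))

/-- Without active facets the polarity condition is vacuous, so the capacity region would contain a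
full ball around `ν`. -/
theorem IsFacetDescription.activeFacets_nonempty (hcb : sw.IsFacetDescription c b)
    (hν : ν ∈ frontier sw.capacityRegion) (hpos : ∀ i, 0 < ν i) :
    (sw.activeFacets c b ν).Nonempty := by
  by_contra hA
  rw [Set.not_nonempty_iff_eq_empty] at hA
  have hνC : ν ∈ sw.capacityRegion := hcb.isClosed.frontier_subset hν
  obtain ⟨δ, hδ, h⟩ := hcb.exists_polar_ball hνC hpos
  refine hν.2 (mem_interior.2 ⟨{x | (x - ν) ⬝ᵥ (x - ν) < δ ^ 2}, fun x hx => ?_, ?_, ?_⟩)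
  · have := h (δ⁻¹ • (x - ν)) (by
      have hx : (x - ν) ⬝ᵥ (x - ν) < δ ^ 2 := hx
      rw [smul_dotProduct, dotProduct_smul, smul_eq_mul, smul_eq_mul, ← mul_assoc, ← sq, inv_pow,
        inv_mul_le_iff₀ (by positivity), mul_one]
      exact hx.le) (by simp [hA])
    rwa [smul_smul, mul_inv_cancel₀ hδ.ne', one_smul, add_sub_cancel] at this
  · refine isOpen_lt ?_ continuous_const
    unfold dotProduct; fun_prop
  · simp; positivity

end GeneralizedSwitch

theorem tendsto_hadamardSum {ι X : Type*} [Fintype ι] (A : Matrix ι ι ℝ) {l : Filter X}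
    {B : X → Matrix ι ι ℝ} {B₀ : Matrix ι ι ℝ} (h : ∀ i j, Tendsto (fun x => B x i j) l (𝓝 (B₀ i j))) :
    Tendsto (fun x => hadamardSum A (B x)) l (𝓝 (hadamardSum A B₀)) := by
  simp only [hadamardSum_eq]
  exact tendsto_finsetSum _ fun i _ => tendsto_finsetSum _ fun j _ => (h i j).const_mul _

open GeneralizedSwitch in
theorem theorem1 {n : ℕ} {M : Type*} [Fintype M] (sw : GeneralizedSwitch n M)
    {L : ℕ} (c : Fin L → Fin n → ℝ) (b : Fin L → ℝ) (hcb : sw.IsFacetDescription c b)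
    (ν : Fin n → ℝ) (hν : ν ∈ frontier sw.capacityRegion)
    (hint : ∀ ε ∈ Set.Ioo (0 : ℝ) 1, (1 - ε) • ν ∈ interior sw.capacityRegion)
    -- a maximal linearly independent subfamily of the normals of the facets that contain `ν`
    (T : Finset (Fin L)) (hTP : (T : Set (Fin L)) ⊆ sw.activeFacets c b ν)
    (hTind : LinearIndependent ℝ (fun ℓ : T => c ℓ))
    (hTspan : Submodule.span ℝ (c '' T) = Submodule.span ℝ (c '' sw.activeFacets c b ν))
    -- the switches indexed by `ε`, each in steady state
    (Amax : ℝ) (α : ℝ → Measure (Fin n → ℝ))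
    (hα : ∀ ε ∈ Set.Ioo (0 : ℝ) 1, IsArrivalLaw (α ε) Amax ((1 - ε) • ν))
    (sched : ℝ → M → Kernel (Fin n → ℝ) (Fin n → ℝ))
    (hsched : ∀ ε ∈ Set.Ioo (0 : ℝ) 1, sw.IsMaxWeight (sched ε))
    (μ : ℝ → Measure (Fin n → ℝ))
    (hμ : ∀ ε ∈ Set.Ioo (0 : ℝ) 1, sw.IsSteadyState (α ε) (sched ε) (μ ε))
    (C : Matrix (Fin n) T ℝ) (hC : C = colMatrix c T)
    (H : Matrix (Fin n) (Fin n) ℝ) (hH : H = C * (Cᵀ * C)⁻¹ * Cᵀ)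
    (SigmaB : Matrix T T ℝ) (hSigmaB : SigmaB = (sw.covB c).submatrix (↑) (↑)) :
    (∀ w : Fin n → ℝ, (∀ ℓ ∈ sw.activeFacets c b ν, w ∈ sw.facet (c ℓ) (b ℓ)) →
      ∀ ε ∈ Set.Ioo (0 : ℝ) 1, Integrable (fun q => q ⬝ᵥ w) (μ ε)) ∧
    (∃ K : ℝ → ℝ, Tendsto (fun ε => ε * K ε) (𝓝[>] 0) (𝓝 0) ∧
      ∀ w : Fin n → ℝ, (∀ ℓ ∈ sw.activeFacets c b ν, w ∈ sw.facet (c ℓ) (b ℓ)) →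
      ∀ ε ∈ Set.Ioo (0 : ℝ) 1,
        |(∫ q, q ⬝ᵥ w ∂(μ ε)) - 1 / (2 * ε) * hadamardSum H (covMat (α ε))
          - 1 / (2 * ε) * hadamardSum (Cᵀ * C)⁻¹ SigmaB| ≤ K ε) ∧
    (∀ SigmaA : Matrix (Fin n) (Fin n) ℝ,
      (∀ i j, Tendsto (fun ε => covMat (α ε) i j) (𝓝[>] 0) (𝓝 (SigmaA i j))) →
      ∀ w : Fin n → ℝ, (∀ ℓ ∈ sw.activeFacets c b ν, w ∈ sw.facet (c ℓ) (b ℓ)) →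
      Tendsto (fun ε => ε * ∫ q, q ⬝ᵥ w ∂(μ ε)) (𝓝[>] 0)
        (𝓝 (1 / 2 * (hadamardSum H SigmaA + hadamardSum (Cᵀ * C)⁻¹ SigmaB)))) := by
  have hH' : H = projMatrix c T := by rw [hH, hC]; rfl
  clear hH
  subst hH' hC hSigmaB
  have hνC : ν ∈ sw.capacityRegion := hcb.isClosed.frontier_subset hν
  have hpos : ∀ i, 0 < ν i := fun i => by
    have := hcb.pos_of_mem_interior (hint (1 / 2) (by norm_num)) i
    simp only [Pi.smul_apply, smul_eq_mul] at this
    linarith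
  -- An active facet is what places `w` in the capacity region, hence bounds its entries by a
  -- constant independent of `w`.
  obtain ⟨ℓ₀, hℓ₀⟩ := hcb.activeFacets_nonempty hν hpos
  have hint1 : ∀ ε ∈ Set.Ioo (0 : ℝ) 1, Integrable (fun q => q ⬝ᵥ q) (μ ε) := fun ε hε => by
    have := (hα ε hε).prob
    exact (hμ ε hε).integrable_dotProduct_self (hsched ε hε) (hα ε hε) (hint ε hε)
  have happly : ∀ ε ∈ Set.Ioo (0 : ℝ) 1, ∀ i, Integrable (fun q => q i) (μ ε) := fun ε hε => by
    have := (hμ ε hε).prob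
    exact integrable_apply_of_dotProduct_self (hint1 ε hε)
  have hmean : ∀ ε ∈ Set.Ioo (0 : ℝ) 1, ∀ w : Fin n → ℝ,
      HasMean (μ ε) (fun q => q ⬝ᵥ w) ((fun i => ∫ q, q i ∂(μ ε)) ⬝ᵥ w) := fun ε hε w => by
    have := HasMean.dotProduct w fun i => HasMean.of_integrable (happly ε hε i)
    simpa only [dotProduct_comm w] using this
  have hbound : ∃ K : ℝ → ℝ, Tendsto (fun ε => ε * K ε) (𝓝[>] 0) (𝓝 0) ∧
      ∀ w : Fin n → ℝ, (∀ ℓ ∈ sw.activeFacets c b ν, w ∈ sw.facet (c ℓ) (b ℓ)) →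
      ∀ ε ∈ Set.Ioo (0 : ℝ) 1,
        |(∫ q, q ⬝ᵥ w ∂(μ ε)) - 1 / (2 * ε) * hadamardSum (projMatrix c T) (covMat (α ε))
          - 1 / (2 * ε) * hadamardSum ((colMatrix c T)ᵀ * colMatrix c T)⁻¹
            ((sw.covB c).submatrix (↑) (↑))| ≤ K ε := by
    obtain ⟨R₁, hR₁, hR₁'⟩ := sw.exists_rate_bound
    obtain ⟨R, hR0, hAR, hR⟩ : ∃ R : ℝ, 0 ≤ R ∧ Amax ≤ R ∧ ∀ m, ∀ x ∈ sw.S m, ∀ i, x i ≤ R :=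
      ⟨max R₁ Amax, le_max_of_le_left hR₁, le_max_right _ _,
        fun m x hx i => (hR₁' m x hx i).trans (le_max_left _ _)⟩
    obtain ⟨W, p, hK⟩ := exists_isConeProjection_bipolarCone c (sw.activeFacets c b ν)
    obtain ⟨ε₀, D₀, hε₀, hD₀⟩ := hcb.exists_state_space_collapse hνC hpos Amax hK
    set D := max D₀ 0 with hD
    have hD0 : 0 ≤ D := le_max_right _ _
    obtain ⟨y, hy, hyν⟩ := id hνC
    have hsupp : ∀ ℓ ∈ sw.activeFacets c b ν, ∀ x ∈ sw.capacityRegion,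
        c ℓ ⬝ᵥ x ≤ c ℓ ⬝ᵥ ν := fun ℓ hℓ x hx => hℓ.2.symm ▸ (hcb.mem_iff.1 hx).2 ℓ
    have hyA : ∀ m, 0 < sw.ψ m → ∀ ℓ ∈ sw.activeFacets c b ν,
        c ℓ ⬝ᵥ y m = sw.maxRate (c ℓ) m := fun m hm ℓ hℓ =>
      dotProduct_eq_maxRate_of_supporting hy (hyν ▸ hsupp ℓ hℓ) hm
    have hνmax : ∀ ℓ ∈ sw.activeFacets c b ν,
        c ℓ ⬝ᵥ ν = ∑ m, sw.ψ m * sw.maxRate (c ℓ) m := fun ℓ hℓ => by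
      rw [hyν, dotProduct_sum]
      refine Finset.sum_congr rfl fun m _ => ?_
      rw [dotProduct_smul, smul_eq_mul]
      rcases (sw.ψ_mem.1 m).eq_or_lt with h | h
      · rw [← h, zero_mul, zero_mul]
      · rw [hyA m h ℓ hℓ]
    obtain ⟨κ, hκ0, hκ⟩ := exists_drift_error_bound hcb.c_nonneg hTind hTP hTspan hK hR0 hR hy hyA
    obtain ⟨κ₀, hκ₀0, hκ₀⟩ := exists_abs_mulVec_le (projMatrix c T)
    set β := ∑ ℓ ∈ T, b ℓ with hβ
    have hβ0 : 0 ≤ β := Finset.sum_nonneg fun ℓ _ => (hcb.b_pos ℓ).le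
    set V := ν ⬝ᵥ projMatrix c T *ᵥ ν with hV
    set S : ℝ → ℝ := fun ε => hadamardSum (projMatrix c T) (covMat (α ε)) +
      hadamardSum ((colMatrix c T)ᵀ * colMatrix c T)⁻¹ ((sw.covB c).submatrix (↑) (↑)) with hS
    set k := n * R * (1 + κ₀) with hk
    have hk0 : 0 ≤ k := by positivity
    -- The terms are the cost of replacing `w` by `Hν`, the drift error with `η = √ε` divided by `2
    -- * ε`, and the second-order term in `ν`. For `ε ≥ ε₀`, where state space collapse is not
    -- available, a crude bound uniform in `w` is added; it does not affect the limit.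
    refine ⟨fun ε => k * (1 + D) + κ * (D + β) * (√ε / ε) + ε * |V| / 2 +
      if ε < ε₀ then 0 else (∑ i, |∫ q, q i ∂(μ ε)| * R) + |S ε / (2 * ε)|, ?_, ?_⟩
    · have h1 : Tendsto (fun ε : ℝ => ε * (k * (1 + D)) + κ * (D + β) * √ε + ε ^ 2 * |V| / 2)
          (𝓝[>] 0) (𝓝 0) := by
        have : Continuous fun ε : ℝ =>
            ε * (k * (1 + D)) + κ * (D + β) * √ε + ε ^ 2 * |V| / 2 := by fun_prop
        have := this.tendsto 0
        simp only [zero_mul, Real.sqrt_zero, mul_zero, ne_eq, OfNat.ofNat_ne_zero,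
          not_false_eq_true, zero_pow, zero_div, add_zero] at this
        exact this.mono_left nhdsWithin_le_nhds
      refine h1.congr' ?_
      filter_upwards [Ioo_mem_nhdsGT hε₀] with ε hε
      have hε0 : ε ≠ 0 := hε.1.ne'
      rw [if_pos hε.2]
      field_simp
      ring
    · intro w hw ε hε
      have hε0 := hε.1
      have hwC : w ∈ sw.capacityRegion := (hw ℓ₀ hℓ₀).1
      have hwR : ∀ i, |w i| ≤ R := abs_apply_le_of_mem_capacityRegion hR hwC
      have e1 : 1 / (2 * ε) * hadamardSum (projMatrix c T) (covMat (α ε))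
          + 1 / (2 * ε) * hadamardSum ((colMatrix c T)ᵀ * colMatrix c T)⁻¹
            ((sw.covB c).submatrix (↑) (↑)) = S ε / (2 * ε) := by
        rw [hS]; ring
      rw [sub_sub, e1]
      have := (hμ ε hε).prob
      beta_reduce
      split_ifs with hlt
      · obtain ⟨hWi, hWD⟩ := hD₀ ε ⟨hε0, hlt⟩ _ _ _ (hα ε hε) (hsched ε hε) (hμ ε hε)
        have hWD' : ∫ q, W q ^ 2 ∂(μ ε) ≤ D := hWD.trans (le_max_left _ _)
        have hsq : 0 < √ε := Real.sqrt_pos.2 hε0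
        have hsqe : √ε * √ε = ε := Real.mul_self_sqrt hε0.le
        -- The weight `η = √ε` balances `η * D` against `ε / η`.
        have h1 := (hμ ε hε).abs_mean_projMatrix_sub_le (hsched ε hε) (hα ε hε) hAR (hint1 ε hε)
          hWi hWD' hyν (fun m hm ℓ hℓ => hyA m hm ℓ (hTP hℓ)) (fun ℓ hℓ => (hTP hℓ).2)
          (fun ℓ hℓ => hνmax ℓ (hTP hℓ)) hκ0 hsq (hκ (√ε) hsq)
        set X := (fun i => ∫ q, q i ∂(μ ε)) ⬝ᵥ projMatrix c T *ᵥ ν with hX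
        have h2 : |(∫ q, q ⬝ᵥ w ∂(μ ε)) - X| ≤ k * (1 + D) := by
          have m1 := HasMean.of_integrable hWi
          have m2 := (hmean ε hε w).sub (hmean ε hε (projMatrix c T *ᵥ ν))
          have m3 := ((HasMean.const (P := μ ε) 1).add m1).const_mul k
          have hpt : ∀ q : Fin n → ℝ, |q ⬝ᵥ w - q ⬝ᵥ projMatrix c T *ᵥ ν| ≤ k * (1 + W q ^ 2) :=
            fun q => by
              refine (abs_dotProduct_sub_projMatrix_le hTind hTspan hK hR0 hκ₀ hwR
                (fun ℓ hℓ => by rw [(hw ℓ (hTP hℓ)).2, (hTP hℓ).2]) q).trans ?_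
              refine mul_le_mul_of_nonneg_left ?_ hk0
              nlinarith [sq_nonneg (W q - 1), sq_nonneg (W q)]
          have u1 := m2.mono m3 (ae_of_all _ fun q => (abs_le.1 (hpt q)).2)
          have u2 := (m3.const_mul (-1)).mono m2 (ae_of_all _ fun q => by
            linarith [(abs_le.1 (hpt q)).1])
          have u3 : k * (1 + ∫ q, W q ^ 2 ∂(μ ε)) ≤ k * (1 + D) :=
            mul_le_mul_of_nonneg_left (by linarith) hk0
          rw [(hmean ε hε w).2, abs_le]
          constructor <;> linarith
        have h3 : |X - S ε / (2 * ε)| ≤ κ * (D + β) * (√ε / ε) + ε * |V| / 2 := by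
          have h4 : κ * (√ε * (2 * D) + (1 + 1 / √ε) * (ε * β)) ≤ κ * (√ε * (2 * D + 2 * β)) := by
            refine mul_le_mul_of_nonneg_left ?_ hκ0
            have g1 : 1 / √ε * ε = √ε := by
              rw [one_div, inv_mul_eq_iff_eq_mul₀ hsq.ne', hsqe]
            have g2 : ε ≤ √ε := by
              have : √ε ≤ 1 := Real.sqrt_le_one.2 hε.2.le
              nlinarith
            have g3 : ε * β ≤ √ε * β := mul_le_mul_of_nonneg_right g2 hβ0
            calc √ε * (2 * D) + (1 + 1 / √ε) * (ε * β)
                = √ε * (2 * D) + ε * β + 1 / √ε * ε * β := by ring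
              _ ≤ _ := by rw [g1]; linarith
          have h5 : X - S ε / (2 * ε) = ((2 * ε * X - hadamardSum (projMatrix c T) (covMat (α ε))
              - hadamardSum ((colMatrix c T)ᵀ * colMatrix c T)⁻¹ ((sw.covB c).submatrix (↑) (↑))
              - ε ^ 2 * V) + ε ^ 2 * V) / (2 * ε) := by
            rw [hS]; field_simp; ring
          rw [h5, abs_div, abs_of_pos (show 0 < 2 * ε by linarith), div_le_iff₀ (by linarith)]
          refine (abs_add_le _ _).trans ((add_le_add (h1.trans h4) le_rfl).trans_eq ?_)
          rw [abs_mul, abs_of_nonneg (sq_nonneg ε)]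
          field_simp
        calc _ ≤ |(∫ q, q ⬝ᵥ w ∂(μ ε)) - X| + |X - S ε / (2 * ε)| := abs_sub_le _ _ _
          _ ≤ _ := by linarith
      · have h1 : |∫ q, q ⬝ᵥ w ∂(μ ε)| ≤ ∑ i, |∫ q, q i ∂(μ ε)| * R := by
          rw [(hmean ε hε w).2]
          refine (Finset.abs_sum_le_sum_abs _ _).trans (Finset.sum_le_sum fun i _ => ?_)
          rw [abs_mul]
          exact mul_le_mul_of_nonneg_left (hwR i) (abs_nonneg _)
        have h2 : 0 ≤ k * (1 + D) + κ * (D + β) * (√ε / ε) + ε * |V| / 2 := by positivity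
        calc _ ≤ |∫ q, q ⬝ᵥ w ∂(μ ε)| + |S ε / (2 * ε)| := abs_sub _ _
          _ ≤ _ := by linarith
  refine ⟨fun w _ ε hε => (hmean ε hε w).1, hbound, fun SigmaA hA w hw => ?_⟩
  obtain ⟨K, hK0, hK⟩ := hbound
  set hB := hadamardSum ((colMatrix c T)ᵀ * colMatrix c T)⁻¹ ((sw.covB c).submatrix (↑) (↑))
  have h1 : Tendsto (fun ε => ε * (∫ q, q ⬝ᵥ w ∂(μ ε)) -
      1 / 2 * (hadamardSum (projMatrix c T) (covMat (α ε)) + hB)) (𝓝[>] 0) (𝓝 0) := by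
    refine squeeze_zero_norm' ?_ hK0
    filter_upwards [Ioo_mem_nhdsGT zero_lt_one] with ε hε
    have hε0 := hε.1
    have e1 : ε * (∫ q, q ⬝ᵥ w ∂(μ ε)) -
        1 / 2 * (hadamardSum (projMatrix c T) (covMat (α ε)) + hB) =
        ε * ((∫ q, q ⬝ᵥ w ∂(μ ε)) - 1 / (2 * ε) * hadamardSum (projMatrix c T) (covMat (α ε))
          - 1 / (2 * ε) * hB) := by
      field_simp; ring
    rw [e1, Real.norm_eq_abs, abs_mul, abs_of_pos hε0]
    exact mul_le_mul_of_nonneg_left (hK w hw ε hε) hε0.le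
  have h2 := h1.add (((tendsto_hadamardSum (projMatrix c T) hA).add_const hB).const_mul (1 / 2))
  simpa using h2
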